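/- Theorem 1. Let $\mathbb{T}^3$ be the three-dimensional torus with its standard real-analytic structure, let $H_1(\mathbb{T}^3,\mathbb{Z})\cong\mathbb{Z}^3$ be its first singular homology group, and let $p\ge 2$. Let $\mathbf{A}\colon\mathbb{Z}^p\to\operatorname{Aut}(H_1(\mathbb{T}^3,\mathbb{Z}))$ be a homomorphism that is spectrally unitary, meaning that $1$ is an eigenvalue of $\mathbf{A}(\ell)$ for every $\ell\in\mathbb{Z}^p$. Then there exists a homomorphism $\varphi\colon\mathbb{Z}^p\to\operatorname{Diff}^{\omega}(\mathbb{T}^3)$ into the group of real-analytic diffeomorphisms of $\mathbb{T}^3$ such that $\varphi$ is free, i.e. $\varphi(\ell)$ has no fixed point for every $\ell\in\mathbb{Z}^p\setminus\{0\}$, and such that the action induced by $\varphi$ on homology is $\mathbf{A}$, i.e. $\varphi(\ell)_*=\mathbf{A}(\ell)$ on $H_1(\mathbb{T}^3,\mathbb{Z})$ for every $\ell\in\mathbb{Z}^p$. -/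

import Mathlib

open scoped Manifold ContDiff

noncomputable section

namespace FreeTorusActions

/-- The three dimensional torus `𝕋³`, with the product topology and the product real-analytic
manifold structure of three copies of the unit circle. -/
abbrev Torus3 : Type := Circle × Circle × Circle

/-- The model with corners (without boundary) of `𝕋³`. -/
abbrev torusModel :
    ModelWithCorners ℝ
      (EuclideanSpace ℝ (Fin 1) × EuclideanSpace ℝ (Fin 1) × EuclideanSpace ℝ (Fin 1))
      (ModelProd (EuclideanSpace ℝ (Fin 1))
        (ModelProd (EuclideanSpace ℝ (Fin 1)) (EuclideanSpace ℝ (Fin 1)))) :=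
  (𝓡 1).prod ((𝓡 1).prod (𝓡 1))

/-- The real-analytic diffeomorphisms of `𝕋³`. -/
abbrev AnalyticDiffeo : Type := Diffeomorph torusModel torusModel Torus3 Torus3 ω

/-- Real-analytic diffeomorphisms of `𝕋³` form a group under composition. -/
instance : Group AnalyticDiffeo where
  mul f g := g.trans f
  one := Diffeomorph.refl torusModel Torus3 ω
  inv f := f.symm
  mul_assoc _ _ _ := rfl
  one_mul _ := rfl
  mul_one _ := rfl
  inv_mul_cancel f := Diffeomorph.ext fun x => f.symm_apply_apply x

/-- The functor `X ↦ H₁(X, ℤ)`: first singular homology with integer coefficients. -/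
abbrev H1Functor : CategoryTheory.Functor TopCat.{0} (ModuleCat.{0} ℤ) :=
  (AlgebraicTopology.singularHomologyFunctor (ModuleCat.{0} ℤ) 1).obj (ModuleCat.of ℤ ℤ)

/-- The first singular homology group `H₁(𝕋³, ℤ)`. -/
abbrev H1Torus3 : Type := H1Functor.obj (TopCat.of Torus3)

/-- The endomorphism `f_*` of `H₁(𝕋³, ℤ)` induced by a continuous map `f : 𝕋³ → 𝕋³`. -/
def inducedH1 (f : C(Torus3, Torus3)) : H1Torus3 →ₗ[ℤ] H1Torus3 :=
  (H1Functor.map (TopCat.ofHom f)).hom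

/-- A `ℤᵖ`-action on `H₁(𝕋³, ℤ)` by automorphisms is spectrally unitary if `1` is an
eigenvalue of the automorphism `A(ℓ)` for every `ℓ ∈ ℤᵖ`. -/
def SpectrallyUnitary {p : ℕ}
    (A : Multiplicative (Fin p → ℤ) →* (H1Torus3 ≃ₗ[ℤ] H1Torus3)) : Prop :=
  ∀ l : Fin p → ℤ,
    Module.End.HasEigenvalue (A (Multiplicative.ofAdd l) : H1Torus3 →ₗ[ℤ] H1Torus3) 1

/-- A `ℤᵖ`-action on `𝕋³` is free if no `φ(ℓ)` with `ℓ ≠ 0` has a fixed point. -/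
def FreeAction {p : ℕ} (φ : Multiplicative (Fin p → ℤ) →* AnalyticDiffeo) : Prop :=
  ∀ l : Fin p → ℤ, l ≠ 0 → ∀ x : Torus3, φ (Multiplicative.ofAdd l) x ≠ x

/-- The action induced by `φ` on `H₁(𝕋³, ℤ)` is `A`: `φ(ℓ)_* = A(ℓ)` for every `ℓ ∈ ℤᵖ`. -/
def InducedActionEq {p : ℕ} (φ : Multiplicative (Fin p → ℤ) →* AnalyticDiffeo)
    (A : Multiplicative (Fin p → ℤ) →* (H1Torus3 ≃ₗ[ℤ] H1Torus3)) : Prop :=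
  ∀ l : Fin p → ℤ,
    inducedH1 ⟨φ (Multiplicative.ofAdd l), (φ (Multiplicative.ofAdd l)).continuous⟩ =
      (A (Multiplicative.ofAdd l) : H1Torus3 →ₗ[ℤ] H1Torus3)

end FreeTorusActions

end

open scoped Manifold ContDiff

noncomputable section

namespace FreeTorusActions

section

open Matrix

/-! ### The exponential map and the toral endomorphisms -/

/-! Winding numbers identify `H₁(𝕋³, ℤ)` with `ℤ³` (`homologyEquiv`), so `A` becomes a family of
commuting integer matrices `M l`, multiplicative in `l`, with `det (M l - 1) = 0`. A map `z ↦ toral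
M z * torusExp (u z)` with `u` continuous acts on homology by `M`
(`HasLinearPart.homologyEquiv_inducedH1`). It remains to find commuting analytic maps with the
prescribed linear parts and no fixed points.

The dichotomy is `exists_fixed_or_klein`. Over `ℂ`, each `l` lies in the kernel of some common
eigencharacter of the family, and there are at most three of these. Either one is trivial, which
gives a rational common fixed vector, or three proper subgroups cover `ℤᵖ`. In the latter case the
three characters are the nontrivial characters of a Klein four-group quotient. The dichotomy is
applied to `M` and to its transposes; a fixed covector excludes the Klein case for `M`.

With a fixed vector and a fixed covector, an affine action works (`exists_free_affine_action`). Its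
translation part is a combination of rational cocycles whose coefficients are, up to the factor
`2π`, linearly independent over `ℚ` together with `1`. At a fixed point of the `l`-th map, pairing
with any rational covector fixed by `M l` yields a rational relation, so every cocycle pairs to zero
with it at `l`. Enough cocycles to prevent this are written down in triangular coordinates
(`hasSeparatingCocycles_of_fixed`).

In the Klein case no affine action is free: the finite index kernel would act by translations, and
commutation with the two sign matrices makes these torsion. Integer eigencovectors, the rows of `P`,
diagonalize `M`. In the coordinates `toral P` the vector field `(sin 2x, cos x, sin x)`, with `x`
the first coordinate, has no zeros. Its symmetries are `x ↦ x + π` with linear part `diag(1, -1,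
-1)` and `x ↦ -x` with linear part `diag(-1, 1, -1)`. Its flow therefore commutes with two affine
maps `f₁`, `f₂` realizing generators of the Klein group. The action is `f₁ ^ n₁ l * f₂ ^ n₂ l *
(flow at time s l)` with `s` additive and `s l / π` irrational for `l ≠ 0`
(`exists_free_klein_action`). -/

/-- The coordinates of a point of `𝕋³`. -/
def coords (z : Torus3) : Fin 3 → Circle := ![z.1, z.2.1, z.2.2]

/-- The point of `𝕋³` with given coordinates. -/
def ofCoords (y : Fin 3 → Circle) : Torus3 := (y 0, y 1, y 2)

@[simp] lemma coords_ofCoords (y : Fin 3 → Circle) : coords (ofCoords y) = y := by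
  ext i; fin_cases i <;> rfl

@[simp] lemma ofCoords_coords (z : Torus3) : ofCoords (coords z) = z := rfl

lemma torus_ext {z w : Torus3} (h : ∀ i, coords z i = coords w i) : z = w := by
  rw [← ofCoords_coords z, ← ofCoords_coords w, funext h]

@[simp] lemma coords_mul (z w : Torus3) (i : Fin 3) :
    coords (z * w) i = coords z i * coords w i := by
  fin_cases i <;> rfl

@[simp] lemma coords_one (i : Fin 3) : coords 1 i = 1 := by
  fin_cases i <;> rfl

lemma continuous_coords : Continuous coords := by
  refine continuous_pi fun i => ?_
  fin_cases i
  · exact continuous_fst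
  · exact continuous_fst.comp continuous_snd
  · exact continuous_snd.comp continuous_snd

lemma continuous_ofCoords : Continuous ofCoords :=
  (continuous_apply 0).prodMk ((continuous_apply 1).prodMk (continuous_apply 2))

/-- The universal covering `ℝ³ → 𝕋³`, with kernel `2πℤ³`. -/
def torusExp (x : Fin 3 → ℝ) : Torus3 := ofCoords fun i => Circle.exp (x i)

@[simp] lemma coords_torusExp (x : Fin 3 → ℝ) (i : Fin 3) :
    coords (torusExp x) i = Circle.exp (x i) := by
  simp [torusExp]

lemma continuous_torusExp : Continuous torusExp :=
  continuous_ofCoords.comp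
    (continuous_pi fun i => Circle.exp.continuous.comp (continuous_apply i))

lemma torusExp_add (x y : Fin 3 → ℝ) : torusExp (x + y) = torusExp x * torusExp y :=
  torus_ext fun i => by simp [Circle.exp_add]

@[simp] lemma torusExp_zero : torusExp 0 = 1 := torus_ext fun i => by simp

lemma torusExp_surjective : Function.Surjective torusExp := fun z => by
  choose x hx using fun i => Circle.exp_surjective (coords z i)
  exact ⟨x, torus_ext fun i => by simp [hx]⟩

/-- The element of `2πℤ³` with given integer coordinates. -/
def period (k : Fin 3 → ℤ) : Fin 3 → ℝ := fun i => 2 * Real.pi * k i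

lemma period_add (k l : Fin 3 → ℤ) : period (k + l) = period k + period l := by
  ext i; simp [period, mul_add]

lemma period_injective : Function.Injective period := fun k l h => by
  ext i
  simpa [period, Real.pi_ne_zero] using congrFun h i

@[simp] lemma period_zero : period 0 = 0 := by ext i; simp [period]

lemma torusExp_eq_iff {x y : Fin 3 → ℝ} :
    torusExp x = torusExp y ↔ ∃ k, x = y + period k := by
  constructor
  · intro h
    have (i : Fin 3) : ∃ m : ℤ, x i = y i + m * (2 * Real.pi) := by
      rw [← Circle.exp_eq_exp, ← coords_torusExp, h, coords_torusExp]
    choose k hk using this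
    exact ⟨k, by ext i; simp [hk, period]; ring⟩
  · rintro ⟨k, rfl⟩
    refine torus_ext fun i => ?_
    simp only [coords_torusExp]
    exact Circle.exp_eq_exp.2 ⟨k i, by simp [period]; ring⟩

lemma torusExp_eq_one_iff {x : Fin 3 → ℝ} : torusExp x = 1 ↔ ∃ k, x = period k := by
  simpa using torusExp_eq_iff (x := x) (y := 0)

@[simp] lemma torusExp_period (k : Fin 3 → ℤ) : torusExp (period k) = 1 :=
  torusExp_eq_one_iff.2 ⟨k, rfl⟩

/-- The endomorphism of `𝕋³` given by an integer matrix. -/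
def toral (M : Matrix (Fin 3) (Fin 3) ℤ) (z : Torus3) : Torus3 :=
  ofCoords fun i => ∏ j, coords z j ^ M i j

/-- An integer matrix as a real matrix. -/
abbrev realMat (M : Matrix (Fin 3) (Fin 3) ℤ) : Matrix (Fin 3) (Fin 3) ℝ :=
  M.map (Int.cast : ℤ → ℝ)

lemma realMat_mul (M N : Matrix (Fin 3) (Fin 3) ℤ) :
    realMat (M * N) = realMat M * realMat N :=
  Matrix.map_mul (f := Int.castRingHom ℝ)

@[simp] lemma realMat_one : realMat 1 = 1 :=
  Matrix.map_one _ Int.cast_zero Int.cast_one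

lemma toral_torusExp (M : Matrix (Fin 3) (Fin 3) ℤ) (x : Fin 3 → ℝ) :
    toral M (torusExp x) = torusExp (realMat M *ᵥ x) := by
  refine torus_ext fun i => ?_
  simp [toral, Fin.prod_univ_three, Matrix.mulVec, dotProduct, Fin.sum_univ_three,
    Circle.exp_add, ← Circle.exp_intCast_mul]

lemma realMat_mulVec_period (M : Matrix (Fin 3) (Fin 3) ℤ) (k : Fin 3 → ℤ) :
    realMat M *ᵥ period k = period (M *ᵥ k) := by
  ext i
  simp [Matrix.mulVec, dotProduct, period, Fin.sum_univ_three]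
  ring

lemma toral_mul (M : Matrix (Fin 3) (Fin 3) ℤ) (z w : Torus3) :
    toral M (z * w) = toral M z * toral M w := by
  obtain ⟨x, rfl⟩ := torusExp_surjective z
  obtain ⟨y, rfl⟩ := torusExp_surjective w
  simp [← torusExp_add, toral_torusExp, Matrix.mulVec_add]

lemma toral_comp (M N : Matrix (Fin 3) (Fin 3) ℤ) (z : Torus3) :
    toral (M * N) z = toral M (toral N z) := by
  obtain ⟨x, rfl⟩ := torusExp_surjective z
  simp [toral_torusExp, realMat_mul, -Matrix.map_mul]

@[simp] lemma toral_one (z : Torus3) : toral 1 z = z := by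
  obtain ⟨x, rfl⟩ := torusExp_surjective z
  simp [toral_torusExp]

end

section

open Matrix CategoryTheory Simplicial

/-! ### Integral chains of a simplicial set -/

section Chains

variable (S : SSet.{0})

/-- The simplicial chain complex with integer coefficients. -/
abbrev intChains : ChainComplex (ModuleCat.{0} ℤ) ℕ := S.chainComplex (ModuleCat.of ℤ ℤ)

variable {S}

/-- The chain given by a single simplex. -/
def chain {n : ℕ} (σ : S _⦋n⦌) : (intChains S).X n :=
  (S.ιChainComplex (R := ModuleCat.of ℤ ℤ) σ).hom (1 : ℤ)

lemma chain_ext {n : ℕ} {T : ModuleCat.{0} ℤ} {f g : (intChains S).X n ⟶ T}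
    (h : ∀ σ, f.hom (chain σ) = g.hom (chain σ)) : f = g := by
  refine SSet.chainComplex_hom_ext fun σ => ?_
  ext
  exact h σ

/-- The homomorphism on chains with prescribed values on simplices. -/
def chainDesc {n : ℕ} (T : ModuleCat.{0} ℤ) (φ : S _⦋n⦌ → T) : (intChains S).X n ⟶ T :=
  Limits.Cofan.IsColimit.desc (S.isColimitChainComplexXCofan (ModuleCat.of ℤ ℤ) n)
    fun σ => ModuleCat.ofHom (LinearMap.toSpanSingleton ℤ T (φ σ))

@[simp] lemma chainDesc_chain {n : ℕ} (T : ModuleCat.{0} ℤ) (φ : S _⦋n⦌ → T) (σ : S _⦋n⦌) :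
    (chainDesc T φ).hom (chain σ) = φ σ := by
  have h := Limits.Cofan.IsColimit.fac (S.isColimitChainComplexXCofan (ModuleCat.of ℤ ℤ) n)
    (fun σ => ModuleCat.ofHom (LinearMap.toSpanSingleton ℤ T (φ σ))) σ
  have h' := congrArg (fun f => f.hom (1 : ℤ)) h
  refine h'.trans ?_
  exact LinearMap.toSpanSingleton_apply_one ℤ _ _

lemma d_chain_one (σ : S _⦋1⦌) :
    ((intChains S).d 1 0).hom (chain σ) = chain (S.δ 0 σ) - chain (S.δ 1 σ) := by
  have h := congrArg (fun f => f.hom (1 : ℤ)) (S.ιChainComplex_d (ModuleCat.of ℤ ℤ) σ)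
  refine h.trans ?_
  simp [Fin.sum_univ_two, chain, sub_eq_add_neg]

lemma d_chain_two (σ : S _⦋2⦌) :
    ((intChains S).d 2 1).hom (chain σ) =
      chain (S.δ 0 σ) - chain (S.δ 1 σ) + chain (S.δ 2 σ) := by
  have h := congrArg (fun f => f.hom (1 : ℤ)) (S.ιChainComplex_d (ModuleCat.of ℤ ℤ) σ)
  refine h.trans ?_
  simp [Fin.sum_univ_three, chain, sub_eq_add_neg]

lemma chainComplexMap_chain {S' : SSet.{0}} (f : S ⟶ S') {n : ℕ} (σ : S _⦋n⦌) :
    ((SSet.chainComplexMap f (ModuleCat.of ℤ ℤ)).f n).hom (chain σ) = chain (f.app _ σ) :=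
  congrArg (fun f => f.hom (1 : ℤ))
    (SSet.ι_chainComplexMap_f S S' f (ModuleCat.of ℤ ℤ) σ)

/-- The class of a `1`-simplex modulo boundaries. -/
def cls (σ : S _⦋1⦌) : (intChains S).opcycles 1 := ((intChains S).pOpcycles 1).hom (chain σ)

lemma cls_face (τ : S _⦋2⦌) : cls (S.δ 0 τ) - cls (S.δ 1 τ) + cls (S.δ 2 τ) = 0 := by
  have h := congrArg (fun f => f.hom (chain τ)) ((intChains S).d_pOpcycles 2 1)
  simp only [ModuleCat.hom_comp, LinearMap.comp_apply, d_chain_two, map_add, map_sub] at h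
  exact h

end Chains

/-! ### Lifting singular simplices to the universal covering -/

section Lift

instance (n : ℕ) : ContractibleSpace (stdSimplex ℝ (Fin (n + 1))) :=
  (convex_stdSimplex ℝ _).contractibleSpace ⟨_, (stdSimplex.vertex (S := ℝ) (0 : Fin (n + 1))).2⟩

/-- Homotopy lifting applied to a contraction of `A` run backwards: it starts at a constant map,
which lifts, and ends at `g`. -/
lemma exists_circle_lift {A : Type*} [TopologicalSpace A] [ContractibleSpace A]
    (g : C(A, Circle)) : ∃ F : C(A, ℝ), ∀ a, Circle.exp (F a) = g a := by
  obtain ⟨a₀, ⟨H⟩⟩ := id_nullhomotopic A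
  obtain ⟨e, he⟩ := Circle.exp_surjective (g a₀)
  let G : C(unitInterval × A, Circle) := g.comp H.symm.toContinuousMap
  have hG (a : A) : G (0, a) = Circle.exp (ContinuousMap.const A e a) := by
    simp [G, he]
  have h := Circle.isCoveringMap_exp.liftHomotopy_lifts G (.const A e) hG
  refine ⟨(Circle.isCoveringMap_exp.liftHomotopy G (.const A e) hG).comp
    ⟨fun a => (1, a), by fun_prop⟩, fun a => ?_⟩
  refine (congrFun h (1, a)).trans ?_
  simp [G]

lemma exists_torus_lift {A : Type*} [TopologicalSpace A] [ContractibleSpace A]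
    (g : C(A, Torus3)) : ∃ F : C(A, Fin 3 → ℝ), ∀ a, torusExp (F a) = g a := by
  choose F hF using fun i => exists_circle_lift
    (⟨fun a => coords (g a) i, (continuous_apply i).comp (continuous_coords.comp g.continuous)⟩ :
      C(A, Circle))
  exact ⟨⟨fun a i => F i a, by fun_prop⟩, fun a => torus_ext fun i =>
    (coords_torusExp _ i).trans (hF i a)⟩

/-- Two lifts differ by a continuous function with values in the discrete set `2πℤ³`, which is
constant on a connected space. -/
lemma lift_sub_lift_eq {A : Type*} [TopologicalSpace A] [PreconnectedSpace A]
    {F G : C(A, Fin 3 → ℝ)} (h : ∀ a, torusExp (F a) = torusExp (G a)) (a b : A) :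
    F b - F a = G b - G a := by
  choose k hk using fun a => torusExp_eq_iff.1 (h a)
  have hc : Continuous k := by
    refine continuous_pi fun i => ?_
    refine Int.isClosedEmbedding_coe_real.isInducing.continuous_iff.2 ?_
    have : ((↑) : ℤ → ℝ) ∘ (fun a => k a i) = fun a => (F a i - G a i) / (2 * Real.pi) := by
      ext a
      simp [hk, period, Real.pi_ne_zero]
    rw [this]
    fun_prop
  rw [hk, hk, PreconnectedSpace.constant ‹_› hc (x := a) (y := b)]
  abel

end Lift

/-! ### The first homology group of the torus -/

/-- The singular simplicial set of `𝕋³`. -/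
abbrev singTorus : SSet.{0} := TopCat.toSSet.obj (TopCat.of Torus3)

/-- The continuous map given by a singular simplex. -/
def toMap {n : ℕ} (σ : singTorus _⦋n⦌) : C(stdSimplex ℝ (Fin (n + 1)), Torus3) :=
  TopCat.toSSetObjEquiv (TopCat.of Torus3) (.op ⦋n⦌) σ

/-- The singular simplex given by a continuous map. -/
def ofMap {n : ℕ} (g : C(stdSimplex ℝ (Fin (n + 1)), Torus3)) : singTorus _⦋n⦌ :=
  (TopCat.toSSetObjEquiv (TopCat.of Torus3) (.op ⦋n⦌)).symm g

@[simp] lemma toMap_ofMap {n : ℕ} (g : C(stdSimplex ℝ (Fin (n + 1)), Torus3)) :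
    toMap (ofMap g) = g := Equiv.apply_symm_apply _ _

@[simp] lemma ofMap_toMap {n : ℕ} (σ : singTorus _⦋n⦌) : ofMap (toMap σ) = σ :=
  Equiv.symm_apply_apply _ _

/-- The inclusion of a face of the standard simplex. -/
def face {n : ℕ} (i : Fin (n + 2)) :
    C(stdSimplex ℝ (Fin (n + 1)), stdSimplex ℝ (Fin (n + 2))) :=
  ⟨_, stdSimplex.continuous_map (SimplexCategory.δ i)⟩

lemma toMap_δ {n : ℕ} (i : Fin (n + 2)) (σ : singTorus _⦋n + 1⦌) :
    toMap (singTorus.δ i σ) = (toMap σ).comp (face i) := rfl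

lemma δ_ofMap {n : ℕ} (i : Fin (n + 2)) (g : C(stdSimplex ℝ (Fin (n + 2)), Torus3)) :
    singTorus.δ i (ofMap g) = ofMap (g.comp (face i)) := by
  rw [← ofMap_toMap (singTorus.δ i (ofMap g)), toMap_δ, toMap_ofMap]

/-- A vertex of the standard simplex. -/
abbrev vert (n : ℕ) (i : Fin (n + 1)) : stdSimplex ℝ (Fin (n + 1)) := stdSimplex.vertex i

@[simp] lemma face_vert {n : ℕ} (i : Fin (n + 2)) (j : Fin (n + 1)) :
    face i (vert n j) = vert (n + 1) (i.succAbove j) :=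
  stdSimplex.map_vertex _ _

/-- The point of `𝕋³` given by a singular `0`-simplex. -/
def point (σ : singTorus _⦋0⦌) : Torus3 := toMap σ (vert 0 0)

lemma point_δ (i : Fin 2) (σ : singTorus _⦋1⦌) :
    point (singTorus.δ i σ) = toMap σ (vert 1 (i.succAbove 0)) := by
  rw [point, toMap_δ, ContinuousMap.comp_apply, face_vert]

lemma exists_displacement (σ : singTorus _⦋1⦌) :
    ∃ v : Fin 3 → ℝ, ∀ F : C(stdSimplex ℝ (Fin 2), Fin 3 → ℝ),
      (∀ a, torusExp (F a) = toMap σ a) → F (vert 1 1) - F (vert 1 0) = v := by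
  obtain ⟨G, hG⟩ := exists_torus_lift (toMap σ)
  exact ⟨_, fun F hF => lift_sub_lift_eq (fun a => (hF a).trans (hG a).symm) _ _⟩

/-- The difference of the end points of a lift of a singular `1`-simplex. -/
def displacement (σ : singTorus _⦋1⦌) : Fin 3 → ℝ := (exists_displacement σ).choose

lemma displacement_eq {σ : singTorus _⦋1⦌} {F : C(stdSimplex ℝ (Fin 2), Fin 3 → ℝ)}
    (hF : ∀ a, torusExp (F a) = toMap σ a) :
    displacement σ = F (vert 1 1) - F (vert 1 0) :=
  ((exists_displacement σ).choose_spec F hF).symm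

lemma displacement_boundary (τ : singTorus _⦋2⦌) :
    displacement (singTorus.δ 0 τ) - displacement (singTorus.δ 1 τ) +
      displacement (singTorus.δ 2 τ) = 0 := by
  obtain ⟨G, hG⟩ := exists_torus_lift (toMap τ)
  have h (i : Fin 3) : displacement (singTorus.δ i τ) =
      G (vert 2 (i.succAbove 1)) - G (vert 2 (i.succAbove 0)) := by
    rw [displacement_eq (F := G.comp (face i)) (fun a => by simp [hG, toMap_δ])]
    simp [ContinuousMap.comp_apply]
  have e1 : (0 : Fin 3).succAbove 0 = 1 := rfl
  have e2 : (0 : Fin 3).succAbove 1 = 2 := rfl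
  have e3 : (1 : Fin 3).succAbove 0 = 0 := rfl
  have e4 : (1 : Fin 3).succAbove 1 = 2 := rfl
  have e5 : (2 : Fin 3).succAbove 0 = 0 := rfl
  have e6 : (2 : Fin 3).succAbove 1 = 1 := rfl
  rw [h, h, h, e1, e2, e3, e4, e5, e6]
  abel

/-- A section of the universal covering. -/
def section₀ : Torus3 → Fin 3 → ℝ := Function.surjInv torusExp_surjective

@[simp] lemma torusExp_section₀ (z : Torus3) : torusExp (section₀ z) = z :=
  Function.surjInv_eq _ _

/-- The displacement of a path that is not closed is not a period. Subtracting the coboundary of the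
discontinuous function `section₀` makes it one without changing its values on cycles. -/
lemma exists_winding (σ : singTorus _⦋1⦌) : ∃ k : Fin 3 → ℤ,
    period k = displacement σ - section₀ (toMap σ (vert 1 1)) +
      section₀ (toMap σ (vert 1 0)) := by
  obtain ⟨F, hF⟩ := exists_torus_lift (toMap σ)
  obtain ⟨k, hk⟩ := torusExp_eq_iff.1
    ((hF (vert 1 1)).trans (torusExp_section₀ (toMap σ (vert 1 1))).symm)
  obtain ⟨l, hl⟩ := torusExp_eq_iff.1
    ((hF (vert 1 0)).trans (torusExp_section₀ (toMap σ (vert 1 0))).symm)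
  refine ⟨k - l, ?_⟩
  have := period_add (k - l) l
  rw [sub_add_cancel] at this
  rw [displacement_eq hF, hk, hl, this]
  abel

/-- The integral cochain that computes the class of a cycle. -/
def winding (σ : singTorus _⦋1⦌) : Fin 3 → ℤ := (exists_winding σ).choose

lemma period_winding (σ : singTorus _⦋1⦌) :
    period (winding σ) = displacement σ - section₀ (toMap σ (vert 1 1)) +
      section₀ (toMap σ (vert 1 0)) := (exists_winding σ).choose_spec

lemma winding_boundary (τ : singTorus _⦋2⦌) :
    winding (singTorus.δ 0 τ) - winding (singTorus.δ 1 τ) + winding (singTorus.δ 2 τ) = 0 := by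
  apply period_injective
  have h (k l m : Fin 3 → ℤ) : period (k - l + m) = period k - period l + period m := by
    ext i; simp [period]; ring
  have h1 := displacement_boundary τ
  rw [h, period_winding, period_winding, period_winding, period_zero, ← h1]
  simp only [toMap_δ, ContinuousMap.comp_apply, face_vert]
  have e1 : (0 : Fin 3).succAbove 0 = 1 := rfl
  have e2 : (0 : Fin 3).succAbove 1 = 2 := rfl
  have e3 : (1 : Fin 3).succAbove 0 = 0 := rfl
  have e4 : (1 : Fin 3).succAbove 1 = 2 := rfl
  have e5 : (2 : Fin 3).succAbove 0 = 0 := rfl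
  have e6 : (2 : Fin 3).succAbove 1 = 1 := rfl
  rw [e1, e2, e3, e4, e5, e6]
  abel

/-! ### Straightening singular `1`-simplices -/

lemma face_apply_succAbove {n : ℕ} (i : Fin (n + 2)) (b : stdSimplex ℝ (Fin (n + 1)))
    (j : Fin (n + 1)) : face i b (i.succAbove j) = b j := by
  change FunOnFinite.linearMap ℝ ℝ (SimplexCategory.δ i) b (i.succAbove j) = b j
  rw [FunOnFinite.linearMap_apply_apply, Finset.sum_eq_single j]
  · intro k hk hkj
    exact absurd (Fin.succAbove_right_injective (Finset.mem_filter.1 hk).2) hkj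
  · intro h
    exact (h (Finset.mem_filter.2 ⟨Finset.mem_univ j, rfl⟩)).elim

lemma face_apply_self {n : ℕ} (i : Fin (n + 2)) (b : stdSimplex ℝ (Fin (n + 1))) :
    face i b i = 0 := by
  change FunOnFinite.linearMap ℝ ℝ (SimplexCategory.δ i) b i = 0
  rw [FunOnFinite.linearMap_apply_apply]
  refine Finset.sum_eq_zero fun k hk => ?_
  exact absurd (Finset.mem_filter.1 hk).2 (Fin.succAbove_ne i k)

/-- The point of the standard `1`-simplex with second coordinate the projection of `s`
to `[0, 1]`. -/
def edgePoint (s : ℝ) : stdSimplex ℝ (Fin 2) :=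
  ⟨![1 - Set.projIcc (0 : ℝ) 1 zero_le_one s, Set.projIcc (0 : ℝ) 1 zero_le_one s], by
    have h := (Set.projIcc (0 : ℝ) 1 zero_le_one s).2
    constructor
    · intro i
      fin_cases i
      · simpa using h.2
      · exact h.1
    · simp [Fin.sum_univ_two]⟩

lemma continuous_edgePoint : Continuous edgePoint := by
  refine Continuous.subtype_mk (continuous_pi fun i => ?_) _
  have : Continuous fun s => ((Set.projIcc (0 : ℝ) 1 zero_le_one s : Set.Icc (0 : ℝ) 1) : ℝ) :=
    continuous_subtype_val.comp continuous_projIcc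
  fin_cases i
  · exact continuous_const.sub this
  · exact this

lemma edgePoint_apply_one (b : stdSimplex ℝ (Fin 2)) : edgePoint (b 1) = b := by
  have hb : b 0 + b 1 = 1 := by rw [← Fin.sum_univ_two]; exact b.2.2
  have hm : b 1 ∈ Set.Icc (0 : ℝ) 1 := ⟨b.2.1 1, by have := b.2.1 0; change 0 ≤ b 0 at this; linarith⟩
  ext i
  change ![1 - ((Set.projIcc (0 : ℝ) 1 zero_le_one (b 1) : Set.Icc (0 : ℝ) 1) : ℝ),
    ((Set.projIcc (0 : ℝ) 1 zero_le_one (b 1) : Set.Icc (0 : ℝ) 1) : ℝ)] i = b i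
  rw [Set.projIcc_of_mem _ hm]
  fin_cases i
  · change 1 - b 1 = b 0
    linarith
  · rfl

/-- This gives continuity of the cone at its apex: the factor tends to `0` while `G` stays bounded.
-/
lemma continuous_smul_div {E : Type*} [NormedAddCommGroup E] [NormedSpace ℝ E] {G : ℝ → E}
    (hG : Continuous G) {C : ℝ} (hC : ∀ s, ‖G s‖ ≤ C) :
    Continuous fun x : ℝ × ℝ => x.1 • G (x.2 / x.1) := by
  rw [continuous_iff_continuousAt]
  rintro ⟨x, y⟩
  by_cases hx : x = 0
  · subst hx
    rw [ContinuousAt, zero_smul]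
    have h : Filter.Tendsto (fun q : ℝ × ℝ => |q.1| * C) (nhds (0, y)) (nhds 0) := by
      have : Continuous fun q : ℝ × ℝ => |q.1| * C := by fun_prop
      simpa using this.tendsto (0, y)
    refine squeeze_zero_norm (fun q => ?_) h
    rw [norm_smul, Real.norm_eq_abs]
    exact mul_le_mul_of_nonneg_left (hC _) (abs_nonneg _)
  · exact continuousAt_fst.smul
      (hG.continuousAt.comp (continuousAt_snd.div continuousAt_fst hx))

/-- The cone with apex the origin over a path. -/
def cone (F : C(stdSimplex ℝ (Fin 2), Fin 3 → ℝ)) : C(stdSimplex ℝ (Fin 3), Fin 3 → ℝ) where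
  -- At the apex the quotient is `0 / 0`; its default value is harmless because the scalar in front
  -- vanishes.
  toFun a := (a 1 + a 2) • F (edgePoint (a 2 / (a 1 + a 2)))
  continuous_toFun := by
    obtain ⟨C, hC⟩ := (isCompact_range F.continuous).isBounded.exists_norm_le
    have h := continuous_smul_div (F.continuous.comp continuous_edgePoint) (C := C)
      fun s => hC _ ⟨_, rfl⟩
    have c (i : Fin 3) : Continuous fun a : stdSimplex ℝ (Fin 3) => a i :=
      (continuous_apply i).comp continuous_subtype_val
    exact h.comp (((c 1).add (c 2)).prodMk (c 2))

/-- The segment from the origin to `p`. -/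
def ray (p : Fin 3 → ℝ) : C(stdSimplex ℝ (Fin 2), Fin 3 → ℝ) where
  toFun b := b 1 • p
  continuous_toFun :=
    ((continuous_apply 1).comp continuous_subtype_val).smul continuous_const

lemma edgePoint_zero : edgePoint 0 = vert 1 0 := edgePoint_apply_one (vert 1 0)

lemma edgePoint_one : edgePoint 1 = vert 1 1 := edgePoint_apply_one (vert 1 1)

variable (F : C(stdSimplex ℝ (Fin 2), Fin 3 → ℝ))

lemma cone_face_zero : (cone F).comp (face 0) = F := by
  ext1 b
  have h1 : face 0 b 1 = b 0 := face_apply_succAbove 0 b 0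
  have h2 : face 0 b 2 = b 1 := face_apply_succAbove 0 b 1
  have hb : b 0 + b 1 = 1 := by rw [← Fin.sum_univ_two]; exact b.2.2
  simp only [ContinuousMap.comp_apply, cone, ContinuousMap.coe_mk, h1, h2, hb]
  rw [div_one, edgePoint_apply_one, one_smul]

lemma cone_face_one : (cone F).comp (face 1) = ray (F (vert 1 1)) := by
  ext1 b
  have h1 : face 1 b 1 = 0 := face_apply_self 1 b
  have h2 : face 1 b 2 = b 1 := face_apply_succAbove 1 b 1
  simp only [ContinuousMap.comp_apply, cone, ray, ContinuousMap.coe_mk, h1, h2, zero_add]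
  by_cases h : b 1 = 0
  · rw [h, zero_smul, zero_smul]
  · rw [div_self h, edgePoint_one]

lemma cone_face_two : (cone F).comp (face 2) = ray (F (vert 1 0)) := by
  ext1 b
  have h1 : face 2 b 1 = b 1 := face_apply_succAbove 2 b 1
  have h2 : face 2 b 2 = 0 := face_apply_self 2 b
  simp only [ContinuousMap.comp_apply, cone, ray, ContinuousMap.coe_mk, h1, h2, zero_div,
    add_zero, edgePoint_zero]

/-- The universal covering as a continuous map. -/
def torusExpMap : C(Fin 3 → ℝ, Torus3) := ⟨torusExp, continuous_torusExp⟩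

/-- The class modulo boundaries of the image of the segment from the origin to `p`. -/
def rayCls (p : Fin 3 → ℝ) : (intChains singTorus).opcycles 1 :=
  cls (ofMap (torusExpMap.comp (ray p)))

/-- The boundary of the projected cone consists of the path itself and the two rays to its end
points. -/
lemma cls_ofMap_lift : cls (ofMap (torusExpMap.comp F)) =
    rayCls (F (vert 1 1)) - rayCls (F (vert 1 0)) := by
  have h := cls_face (ofMap (torusExpMap.comp (cone F)))
  have e (i : Fin 3) (G) (hG : (cone F).comp (face i) = G) :
      singTorus.δ i (ofMap (torusExpMap.comp (cone F))) = ofMap (torusExpMap.comp G) := by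
    rw [δ_ofMap, ContinuousMap.comp_assoc, ← hG]
  rw [e 0 _ (cone_face_zero F), e 1 _ (cone_face_one F), e 2 _ (cone_face_two F)] at h
  rw [rayCls, rayCls, ← sub_eq_zero, ← h]
  abel

lemma cls_eq_of_lift {σ : singTorus _⦋1⦌} {F : C(stdSimplex ℝ (Fin 2), Fin 3 → ℝ)}
    (hF : ∀ a, torusExp (F a) = toMap σ a) :
    cls σ = rayCls (F (vert 1 1)) - rayCls (F (vert 1 0)) := by
  rw [← cls_ofMap_lift]
  congr 1
  rw [← ofMap_toMap σ]
  congr 1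
  ext1 a
  exact (hF a).symm

/-- The ray to `p` and its translate by a period are lifts of the same simplex; computing its class
from the translate compares the two sides. -/
lemma rayCls_add_period (p : Fin 3 → ℝ) (k : Fin 3 → ℤ) :
    rayCls (p + period k) = rayCls p + rayCls (period k) := by
  have h := cls_eq_of_lift (σ := ofMap (torusExpMap.comp (ray p)))
    (F := ray p + ContinuousMap.const _ (period k)) fun a => by
      simp [torusExp_add, torusExpMap]
  have h1 : ray p (vert 1 1) = p := by simp [ray]
  have h0 : ray p (vert 1 0) = 0 := by simp [ray]
  simp only [ContinuousMap.add_apply, ContinuousMap.const_apply, h1, h0, zero_add] at h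
  rw [rayCls.eq_def p, h, sub_add_cancel]

/-- The class of the loop with given winding numbers. -/
def loopCls : (Fin 3 → ℤ) →ₗ[ℤ] (intChains singTorus).opcycles 1 where
  toFun k := rayCls (period k)
  map_add' k l := by rw [period_add, rayCls_add_period]
  map_smul' n k := by
    let f : (Fin 3 → ℤ) →+ (intChains singTorus).opcycles 1 :=
      AddMonoidHom.mk' (fun k => rayCls (period k)) fun k l => by
        rw [period_add, rayCls_add_period]
    exact (map_zsmul f n k).trans (int_smul_eq_zsmul _ n _).symm

lemma loopCls_apply (k : Fin 3 → ℤ) : loopCls k = rayCls (period k) := rfl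

lemma cls_eq (σ : singTorus _⦋1⦌) : cls σ =
    rayCls (section₀ (toMap σ (vert 1 1))) - rayCls (section₀ (toMap σ (vert 1 0))) +
      loopCls (winding σ) := by
  obtain ⟨F, hF⟩ := exists_torus_lift (toMap σ)
  obtain ⟨k, hk⟩ := torusExp_eq_iff.1
    ((hF (vert 1 1)).trans (torusExp_section₀ (toMap σ (vert 1 1))).symm)
  obtain ⟨l, hl⟩ := torusExp_eq_iff.1
    ((hF (vert 1 0)).trans (torusExp_section₀ (toMap σ (vert 1 0))).symm)
  have hw : winding σ + l = k := by
    apply period_injective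
    rw [period_add, period_winding, displacement_eq hF, hk, hl]
    abel
  rw [cls_eq_of_lift hF, hk, hl, rayCls_add_period, rayCls_add_period, ← loopCls_apply,
    ← loopCls_apply, ← hw, map_add]
  abel

/-! ### The isomorphism `H₁(𝕋³, ℤ) ≅ ℤ³` -/

/-- The winding numbers as a homomorphism on chains modulo boundaries. -/
def windingHom : (intChains singTorus).opcycles 1 ⟶ ModuleCat.of ℤ (Fin 3 → ℤ) :=
  (intChains singTorus).descOpcycles (chainDesc (ModuleCat.of ℤ (Fin 3 → ℤ)) winding) 2
    (by simp) (by
      refine chain_ext fun τ => ?_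
      simp only [ModuleCat.hom_comp, LinearMap.comp_apply, d_chain_two, map_add, map_sub]
      exact (congrArg₂ (· + ·) (congrArg₂ (· - ·) (chainDesc_chain _ _ _)
        (chainDesc_chain _ _ _)) (chainDesc_chain _ _ _)).trans (winding_boundary τ))

lemma pOpcycles_windingHom : (intChains singTorus).pOpcycles 1 ≫ windingHom =
    chainDesc (ModuleCat.of ℤ (Fin 3 → ℤ)) winding :=
  HomologicalComplex.p_descOpcycles ..

lemma windingHom_cls (σ : singTorus _⦋1⦌) : windingHom.hom (cls σ) = winding σ := by
  have := congrArg (fun f => f.hom (chain σ)) pOpcycles_windingHom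
  exact this.trans (chainDesc_chain _ _ _)

lemma fromOpcycles_cls (σ : singTorus _⦋1⦌) :
    ((intChains singTorus).fromOpcycles 1 0).hom (cls σ) =
      chain (singTorus.δ 0 σ) - chain (singTorus.δ 1 σ) := by
  have := congrArg (fun f => f.hom (chain σ)) ((intChains singTorus).p_fromOpcycles 1 0)
  exact this.trans (d_chain_one σ)

lemma opcycles_hom_ext {T : ModuleCat.{0} ℤ} {f g : (intChains singTorus).opcycles 1 ⟶ T}
    (h : ∀ σ, f.hom (cls σ) = g.hom (cls σ)) : f = g := by
  rw [← cancel_epi ((intChains singTorus).pOpcycles 1)]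
  exact chain_ext h

lemma fromOpcycles_loopCls (k : Fin 3 → ℤ) :
    ((intChains singTorus).fromOpcycles 1 0).hom (loopCls k) = 0 := by
  rw [loopCls_apply, rayCls, fromOpcycles_cls, sub_eq_zero]
  congr 1
  rw [← ofMap_toMap (singTorus.δ 0 _), ← ofMap_toMap (singTorus.δ 1 _)]
  congr 1
  ext1 b
  have hb : b = vert 0 0 := Subsingleton.elim (α := stdSimplex ℝ (Fin 1)) _ _
  rw [hb]
  have h0 := point_δ 0 (ofMap (torusExpMap.comp (ray (period k))))
  have h1 := point_δ 1 (ofMap (torusExpMap.comp (ray (period k))))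
  refine h0.trans (Eq.trans ?_ h1.symm)
  have e1 : (0 : Fin 2).succAbove 0 = 1 := rfl
  have e2 : (1 : Fin 2).succAbove 0 = 0 := rfl
  rw [e1, e2, toMap_ofMap]
  simp [torusExpMap, ray]

/-- The loop with given winding numbers as a homology class. -/
def loopHom : ModuleCat.of ℤ (Fin 3 → ℤ) ⟶ (intChains singTorus).homology 1 :=
  ((intChains singTorus).homologyIsKernel 1 0 (by simp)).lift
    (Limits.KernelFork.ofι (ModuleCat.ofHom loopCls) (by
      ext1
      exact LinearMap.ext fun k => fromOpcycles_loopCls k))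

lemma loopHom_homologyι : loopHom ≫ (intChains singTorus).homologyι 1 =
    ModuleCat.ofHom loopCls :=
  ((intChains singTorus).homologyIsKernel 1 0 (by simp)).fac _
    Limits.WalkingParallelPair.zero

lemma loopCls_windingHom : ModuleCat.ofHom loopCls ≫ windingHom = 𝟙 _ := by
  ext1
  refine LinearMap.ext fun k => ?_
  change windingHom.hom (loopCls k) = k
  rw [loopCls_apply, rayCls, windingHom_cls]
  apply period_injective
  rw [period_winding, displacement_eq (F := ray (period k)) (fun a => rfl)]
  simp [ray, torusExpMap]

/-- This is a chain homotopy from the identity to winding numbers followed by standard loops. The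
first summand factors through the boundary map, so it dies on homology, where the two maps become
inverse to each other. -/
lemma pOpcycles_eq : 𝟙 ((intChains singTorus).opcycles 1) =
    (intChains singTorus).fromOpcycles 1 0 ≫
      chainDesc _ (fun σ => rayCls (section₀ (point σ))) +
    windingHom ≫ ModuleCat.ofHom loopCls := by
  refine opcycles_hom_ext fun σ => ?_
  have h := cls_eq σ
  change cls σ = (chainDesc _ (fun σ => rayCls (section₀ (point σ)))).hom
    (((intChains singTorus).fromOpcycles 1 0).hom (cls σ)) + loopCls (windingHom.hom (cls σ))
  rw [fromOpcycles_cls, windingHom_cls, map_sub, chainDesc_chain, chainDesc_chain]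
  rw [point_δ, point_δ]
  exact h

lemma homologyι_winding_loop :
    ((intChains singTorus).homologyι 1 ≫ windingHom) ≫ loopHom = 𝟙 _ := by
  rw [← cancel_mono ((intChains singTorus).homologyι 1), Category.assoc, loopHom_homologyι,
    Category.id_comp, Category.assoc]
  have h := congrArg (fun f => (intChains singTorus).homologyι 1 ≫ f) pOpcycles_eq
  simp only [Preadditive.comp_add, Category.comp_id,
    HomologicalComplex.homologyι_comp_fromOpcycles_assoc, Limits.zero_comp, zero_add] at h
  exact h.symm

/-- The isomorphism `H₁(𝕋³, ℤ) ≅ ℤ³` given by winding numbers. -/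
def homologyIso : (intChains singTorus).homology 1 ≅ ModuleCat.of ℤ (Fin 3 → ℤ) where
  hom := (intChains singTorus).homologyι 1 ≫ windingHom
  inv := loopHom
  hom_inv_id := homologyι_winding_loop
  inv_hom_id := by
    rw [← Category.assoc, loopHom_homologyι, loopCls_windingHom]

/-- The isomorphism `H₁(𝕋³, ℤ) ≅ ℤ³` given by winding numbers. -/
def homologyEquiv : H1Torus3 ≃ₗ[ℤ] (Fin 3 → ℤ) := homologyIso.toLinearEquiv

/-! ### Action on homology of maps with a linear part -/

/-- A continuous map `𝕋³ → 𝕋³` has linear part `M` if it differs from the toral endomorphism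
given by `M` by a displacement that lifts to `ℝ³`. -/
def HasLinearPart (f : Torus3 → Torus3) (M : Matrix (Fin 3) (Fin 3) ℤ) : Prop :=
  ∃ u : Torus3 → Fin 3 → ℝ, Continuous u ∧ ∀ z, f z = toral M z * torusExp (u z)

/-- If `F` lifts `σ`, then `M F + u ∘ σ` lifts `f ∘ σ`. Winding numbers thus transform by `M` up to
the coboundary of `q`, which records how `section₀` fails to commute with the lifted map. -/
lemma HasLinearPart.exists_winding {f : C(Torus3, Torus3)} {M : Matrix (Fin 3) (Fin 3) ℤ}
    (h : HasLinearPart f M) : ∃ q : Torus3 → Fin 3 → ℤ, ∀ σ : singTorus _⦋1⦌,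
      winding (ofMap (f.comp (toMap σ))) = M *ᵥ winding σ + q (toMap σ (vert 1 1)) -
        q (toMap σ (vert 1 0)) := by
  obtain ⟨u, hu, hf⟩ := h
  have hf' (x : Fin 3 → ℝ) : f (torusExp x) = torusExp (realMat M *ᵥ x + u (torusExp x)) := by
    rw [hf, toral_torusExp, torusExp_add]
  have hq (z : Torus3) : ∃ k, realMat M *ᵥ section₀ z + u z = section₀ (f z) + period k := by
    apply torusExp_eq_iff.1
    have := hf' (section₀ z)
    rw [torusExp_section₀] at this
    rw [← this, torusExp_section₀]
  choose q hq using hq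
  refine ⟨q, fun σ => ?_⟩
  obtain ⟨F, hF⟩ := exists_torus_lift (toMap σ)
  have hG : Continuous fun a => realMat M *ᵥ F a + u (toMap σ a) := by
    have : Continuous fun x : Fin 3 → ℝ => realMat M *ᵥ x :=
      Continuous.matrix_mulVec continuous_const continuous_id
    exact (this.comp F.continuous).add (hu.comp (toMap σ).continuous)
  have hGl (a) : torusExp ((⟨_, hG⟩ : C(stdSimplex ℝ (Fin 2), Fin 3 → ℝ)) a) =
      toMap (ofMap (f.comp (toMap σ))) a := by
    rw [toMap_ofMap, ContinuousMap.comp_apply, ← hF a, hf', hF a]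
    rfl
  have hs (k l m : Fin 3 → ℤ) : period (k + l - m) = period k + period l - period m := by
    ext i; simp [period]; ring
  apply period_injective
  rw [hs, period_winding, displacement_eq hGl, ← realMat_mulVec_period, period_winding,
    displacement_eq hF]
  simp only [toMap_ofMap, ContinuousMap.comp_apply, ContinuousMap.coe_mk, mulVec_add, mulVec_sub]
  have h1 := hq (toMap σ (vert 1 1))
  have h0 := hq (toMap σ (vert 1 0))
  rw [← eq_sub_iff_add_eq'] at h1 h0
  rw [h1, h0]
  abel

lemma HasLinearPart.homologyEquiv_inducedH1 {f : C(Torus3, Torus3)}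
    {M : Matrix (Fin 3) (Fin 3) ℤ} (h : HasLinearPart f M) (x : H1Torus3) :
    homologyEquiv (inducedH1 f x) = M *ᵥ homologyEquiv x := by
  obtain ⟨q, hq⟩ := h.exists_winding
  have key : HomologicalComplex.opcyclesMap (SSet.chainComplexMap
        (TopCat.toSSet.map (TopCat.ofHom f)) (ModuleCat.of ℤ ℤ)) 1 ≫ windingHom =
      windingHom ≫ ModuleCat.ofHom M.mulVecLin +
        (intChains singTorus).fromOpcycles 1 0 ≫
          chainDesc (ModuleCat.of ℤ (Fin 3 → ℤ)) (fun σ => q (point σ)) := by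
    refine opcycles_hom_ext fun σ => ?_
    have h1 : (HomologicalComplex.opcyclesMap (SSet.chainComplexMap
        (TopCat.toSSet.map (TopCat.ofHom f)) (ModuleCat.of ℤ ℤ)) 1).hom (cls σ) =
        cls (ofMap (f.comp (toMap σ))) := by
      have := congrArg (fun g => g.hom (chain σ)) (HomologicalComplex.p_opcyclesMap
        (SSet.chainComplexMap (TopCat.toSSet.map (TopCat.ofHom f)) (ModuleCat.of ℤ ℤ)) 1)
      refine this.trans ?_
      exact congrArg ((intChains singTorus).pOpcycles 1).hom (chainComplexMap_chain _ σ)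
    change windingHom.hom ((HomologicalComplex.opcyclesMap (SSet.chainComplexMap
        (TopCat.toSSet.map (TopCat.ofHom f)) (ModuleCat.of ℤ ℤ)) 1).hom (cls σ)) =
      M *ᵥ (windingHom.hom (cls σ)) + (chainDesc (ModuleCat.of ℤ (Fin 3 → ℤ)) (fun σ => q (point σ))).hom
        (((intChains singTorus).fromOpcycles 1 0).hom (cls σ))
    rw [h1, windingHom_cls, windingHom_cls, fromOpcycles_cls, map_sub, chainDesc_chain,
      chainDesc_chain, hq, point_δ, point_δ, add_sub_assoc]
    rfl
  have h2 := congrArg (fun g => (intChains singTorus).homologyι 1 ≫ g) key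
  simp only [Preadditive.comp_add, HomologicalComplex.homologyι_comp_fromOpcycles_assoc,
    Limits.zero_comp, add_zero, ← HomologicalComplex.homologyι_naturality_assoc] at h2
  exact congrArg (fun g => g.hom x) h2

end

section

open Matrix

/-! ### Analytic maps of the torus -/

lemma contMDiff_coords (i : Fin 3) :
    ContMDiff torusModel (𝓡 1) ω (fun z : Torus3 => coords z i) := by
  fin_cases i
  · exact contMDiff_fst
  · exact contMDiff_fst.comp contMDiff_snd
  · exact contMDiff_snd.comp contMDiff_snd

lemma contMDiff_of_coords {f : Torus3 → Torus3}
    (h : ∀ i, ContMDiff torusModel (𝓡 1) ω fun z => coords (f z) i) :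
    ContMDiff torusModel torusModel ω f :=
  (h 0).prodMk ((h 1).prodMk (h 2))

lemma contMDiff_zpow_comp {g : Torus3 → Circle} (hg : ContMDiff torusModel (𝓡 1) ω g) (n : ℤ) :
    ContMDiff torusModel (𝓡 1) ω fun z => g z ^ n := by
  have hn (m : ℕ) : ContMDiff torusModel (𝓡 1) ω fun z => g z ^ m :=
    (contMDiff_pow m).comp hg
  cases n with
  | ofNat m => simpa using hn m
  | negSucc m => simpa [zpow_negSucc] using (hn (m + 1)).inv

lemma contMDiff_toral (M : Matrix (Fin 3) (Fin 3) ℤ) :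
    ContMDiff torusModel torusModel ω (toral M) := by
  refine contMDiff_of_coords fun i => ?_
  simp only [toral, coords_ofCoords, Fin.prod_univ_three]
  exact ((contMDiff_zpow_comp (contMDiff_coords 0) _).mul
    (contMDiff_zpow_comp (contMDiff_coords 1) _)).mul (contMDiff_zpow_comp (contMDiff_coords 2) _)

lemma contMDiff_toral_mul_torusExp (M : Matrix (Fin 3) (Fin 3) ℤ) {u : Torus3 → Fin 3 → ℝ}
    (hu : ∀ i, ContMDiff torusModel 𝓘(ℝ, ℝ) ω fun z => u z i) :
    ContMDiff torusModel torusModel ω fun z => toral M z * torusExp (u z) := by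
  refine contMDiff_of_coords fun i => ?_
  simp only [coords_mul, coords_torusExp]
  exact ((contMDiff_coords i).comp (contMDiff_toral M)).mul (contMDiff_circleExp.comp (hu i))

lemma contMDiff_re_im (i : Fin 3) :
    ContMDiff torusModel 𝓘(ℝ, ℝ × ℝ) ω
      fun z : Torus3 => ((coords z i : ℂ).re, (coords z i : ℂ).im) := by
  have h : ContMDiff torusModel 𝓘(ℝ, ℂ) ω fun z : Torus3 => (coords z i : ℂ) :=
    have := finrank_real_complex_fact'
    (contMDiff_coe_sphere (E := ℂ) (n := 1)).comp (contMDiff_coords i)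
  have h' : ContDiff ℝ ω fun w : ℂ => (w.re, w.im) :=
    Complex.reCLM.contDiff.prodMk Complex.imCLM.contDiff
  exact h'.contMDiff.comp h

/-! ### Diffeomorphism groups and integer matrices on homology -/

/-- A group action by analytic maps as a homomorphism to the group of diffeomorphisms. -/
def actionHom {G : Type*} [Group G] (φ : G → Torus3 → Torus3) (h1 : ∀ z, φ 1 z = z)
    (hmul : ∀ g h z, φ (g * h) z = φ g (φ h z))
    (hφ : ∀ g, ContMDiff torusModel torusModel ω (φ g)) : G →* AnalyticDiffeo where
  toFun g :=
    { toFun := φ g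
      invFun := φ g⁻¹
      left_inv := fun z => by rw [← hmul, inv_mul_cancel, h1]
      right_inv := fun z => by rw [← hmul, mul_inv_cancel, h1]
      contMDiff_toFun := hφ g
      contMDiff_invFun := hφ g⁻¹ }
  map_one' := Diffeomorph.ext h1
  map_mul' g h := Diffeomorph.ext (hmul g h)

lemma analyticDiffeo_mul_apply (f g : AnalyticDiffeo) (z : Torus3) : (f * g) z = f (g z) := rfl

/-- The linear action on homology as a homomorphism. -/
def homologyAction : AnalyticDiffeo →* (H1Torus3 →ₗ[ℤ] H1Torus3) where
  toFun f := inducedH1 ⟨f, f.continuous⟩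
  map_one' := by
    have : TopCat.ofHom (⟨(1 : AnalyticDiffeo), (1 : AnalyticDiffeo).continuous⟩ :
        C(Torus3, Torus3)) = CategoryTheory.CategoryStruct.id (TopCat.of Torus3) := rfl
    rw [inducedH1, this, CategoryTheory.Functor.map_id]
    rfl
  map_mul' f g := by
    have : TopCat.ofHom (⟨(f * g : AnalyticDiffeo), (f * g).continuous⟩ : C(Torus3, Torus3)) =
        CategoryTheory.CategoryStruct.comp
          (TopCat.ofHom (⟨g, g.continuous⟩ : C(Torus3, Torus3)))
          (TopCat.ofHom (⟨f, f.continuous⟩ : C(Torus3, Torus3))) := rfl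
    rw [inducedH1, this, CategoryTheory.Functor.map_comp]
    rfl

/-- The integer matrix of an endomorphism of `H₁(𝕋³, ℤ)`. -/
def homologyMatrix (B : H1Torus3 →ₗ[ℤ] H1Torus3) : Matrix (Fin 3) (Fin 3) ℤ :=
  LinearMap.toMatrix' (homologyEquiv.toLinearMap ∘ₗ B ∘ₗ homologyEquiv.symm.toLinearMap)

lemma homologyMatrix_mulVec (B : H1Torus3 →ₗ[ℤ] H1Torus3) (x : H1Torus3) :
    homologyMatrix B *ᵥ homologyEquiv x = homologyEquiv (B x) := by
  rw [homologyMatrix, ← Matrix.toLin'_apply, Matrix.toLin'_toMatrix']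
  simp

lemma homologyMatrix_mul (B C : H1Torus3 →ₗ[ℤ] H1Torus3) :
    homologyMatrix (B * C) = homologyMatrix B * homologyMatrix C := by
  rw [homologyMatrix, homologyMatrix, homologyMatrix, ← LinearMap.toMatrix'_comp]
  congr 1
  refine LinearMap.ext fun x => ?_
  simp

@[simp] lemma homologyMatrix_one : homologyMatrix 1 = 1 := by
  rw [homologyMatrix, ← LinearMap.toMatrix'_id]
  congr 1
  refine LinearMap.ext fun x => ?_
  simp

/-! ### Affine actions -/

/-- The numbers `α i` together with `1` are independent over `ℚ`: choose one basis vector of `ℝ`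
over `ℚ` more than needed and divide by it. -/
lemma exists_irrational_family (ι : Type*) [Fintype ι] :
    ∃ α : ι → ℝ, ∀ (c : ι → ℚ) (d : ℚ), ∑ i, (c i : ℝ) * α i = d → c = 0 := by
  let b := Module.Basis.ofVectorSpace ℚ ℝ
  have hinf : Infinite (Module.Basis.ofVectorSpaceIndex ℚ ℝ) := by
    rw [Cardinal.infinite_iff, b.mk_eq_rank'', Real.rank_rat_real]
    exact Cardinal.aleph0_le_continuum
  obtain ⟨g⟩ : Nonempty (Option ι ↪ Module.Basis.ofVectorSpaceIndex ℚ ℝ) :=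
    ⟨(Fintype.equivFin (Option ι)).toEmbedding.trans
      (Fin.valEmbedding.trans (Infinite.natEmbedding _))⟩
  have hli : LinearIndependent ℚ fun i => b (g i) := b.linearIndependent.comp _ g.injective
  have h0 : b (g none) ≠ 0 := hli.ne_zero none
  refine ⟨fun i => b (g (some i)) / b (g none), fun c d h => ?_⟩
  have hs : ∑ i : Option ι, (Option.elim i (-d) c : ℚ) • b (g i) = 0 := by
    rw [Fintype.sum_option]
    simp only [Option.elim, Rat.smul_def]
    simp only [← mul_div_assoc, ← Finset.sum_div] at h
    rw [div_eq_iff h0] at h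
    rw [h]
    push_cast
    ring
  ext i
  exact Fintype.linearIndependent_iff.1 hli _ hs (some i)

/-- An integer matrix as a rational matrix. -/
abbrev ratMat (M : Matrix (Fin 3) (Fin 3) ℤ) : Matrix (Fin 3) (Fin 3) ℚ :=
  M.map (Int.cast : ℤ → ℚ)

/-- A rational vector as a real vector. -/
abbrev ratVec (v : Fin 3 → ℚ) : Fin 3 → ℝ := fun i => v i

lemma realMat_mulVec_ratVec (M : Matrix (Fin 3) (Fin 3) ℤ) (v : Fin 3 → ℚ) :
    realMat M *ᵥ ratVec v = ratVec (ratMat M *ᵥ v) := by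
  ext i
  simp [ratVec, Matrix.mulVec, dotProduct, Fin.sum_univ_three]

lemma ratVec_vecMul_realMat (M : Matrix (Fin 3) (Fin 3) ℤ) (v : Fin 3 → ℚ) :
    ratVec v ᵥ* realMat M = ratVec (v ᵥ* ratMat M) := by
  ext i
  simp [ratVec, Matrix.vecMul, dotProduct, Fin.sum_univ_three]

lemma ratVec_dotProduct (v w : Fin 3 → ℚ) : ratVec v ⬝ᵥ ratVec w = ((v ⬝ᵥ w : ℚ) : ℝ) := by
  simp [ratVec, dotProduct, Fin.sum_univ_three]

theorem exists_free_affine_action {p : ℕ} (M : (Fin p → ℤ) → Matrix (Fin 3) (Fin 3) ℤ)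
    (M_zero : M 0 = 1) (M_add : ∀ a b, M (a + b) = M a * M b)
    {ι : Type*} [Fintype ι] (t : ι → (Fin p → ℤ) → Fin 3 → ℚ)
    (ht : ∀ i a b, t i (a + b) = t i a + ratMat (M a) *ᵥ t i b)
    (hfree : ∀ l ≠ 0, ∃ i, ∃ w : Fin 3 → ℚ, w ᵥ* ratMat (M l) = w ∧ w ⬝ᵥ t i l ≠ 0) :
    ∃ φ : Multiplicative (Fin p → ℤ) →* AnalyticDiffeo, FreeAction φ ∧
      ∀ l, HasLinearPart (φ (Multiplicative.ofAdd l)) (M l) := by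
  obtain ⟨α, hα⟩ := exists_irrational_family ι
  let T (l : Fin p → ℤ) : Fin 3 → ℝ := ∑ i, (2 * Real.pi * α i) • ratVec (t i l)
  have hT (a b) : T (a + b) = T a + realMat (M a) *ᵥ T b := by
    simp only [T, Matrix.mulVec_sum, ← Finset.sum_add_distrib, Matrix.mulVec_smul,
      realMat_mulVec_ratVec, ← smul_add]
    refine Finset.sum_congr rfl fun i _ => ?_
    congr 1
    ext j
    simp [ratVec, ht]
  have hT0 : T 0 = 0 := by
    have := hT 0 0
    rw [M_zero, realMat_one, one_mulVec, add_zero] at this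
    simpa using this
  let φ := actionHom (G := Multiplicative (Fin p → ℤ))
    (fun l z => toral (M l.toAdd) z * torusExp (T l.toAdd))
    (fun z => by simp [M_zero, hT0])
    (fun a b z => by
      simp only [toAdd_mul, M_add, hT, toral_comp, toral_mul, torusExp_add, toral_torusExp]
      rw [mul_assoc, mul_comm (torusExp (T _))])
    (fun l => contMDiff_toral_mul_torusExp _ fun i => contMDiff_const)
  refine ⟨φ, fun l hl z hz => ?_, fun l => ⟨fun _ => T l, continuous_const, fun z => rfl⟩⟩
  obtain ⟨i, w, hw, hwt⟩ := hfree l hl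
  obtain ⟨x, rfl⟩ := torusExp_surjective z
  change toral (M l) (torusExp x) * torusExp (T l) = torusExp x at hz
  rw [toral_torusExp, ← torusExp_add, torusExp_eq_iff] at hz
  obtain ⟨k, hk⟩ := hz
  -- Pairing with a covector fixed by `M l` eliminates `x` and leaves `⟨w, T l⟩ ∈ 2πℚ`; independence
  -- of the `α j` then annihilates each coefficient `⟨w, t j l⟩`.
  have h1 := congrArg (fun y => ratVec w ⬝ᵥ y) hk
  simp only [dotProduct_add, dotProduct_mulVec, ratVec_vecMul_realMat, hw] at h1
  have h2 : ratVec w ⬝ᵥ T l = ratVec w ⬝ᵥ period k := by linarith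
  have h3 : ratVec w ⬝ᵥ period k = 2 * Real.pi * ((w ⬝ᵥ fun i => (k i : ℚ) : ℚ) : ℝ) := by
    simp [ratVec, dotProduct, Fin.sum_univ_three, period]
    ring
  have h4 : ratVec w ⬝ᵥ T l = 2 * Real.pi * ∑ j, ((w ⬝ᵥ t j l : ℚ) : ℝ) * α j := by
    simp only [T, dotProduct_sum, dotProduct_smul, ratVec_dotProduct, Finset.mul_sum, smul_eq_mul]
    exact Finset.sum_congr rfl fun j _ => by ring
  rw [h3, h4] at h2
  have h5 := hα (fun j => w ⬝ᵥ t j l) _ (mul_left_cancel₀ (by positivity) h2)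
  exact hwt (congrFun h5 i)

/-! ### Rational cocycles -/

/-- A linear `ℤᵖ`-action on `ℚ³` has separating cocycles if there are finitely many cocycles such
that the class of one of them remains nonzero after restriction to any given cyclic subgroup. -/
def HasSeparatingCocycles {p : ℕ} (B : (Fin p → ℤ) → Matrix (Fin 3) (Fin 3) ℚ) : Prop :=
  ∃ (ι : Type) (_ : Fintype ι) (t : ι → (Fin p → ℤ) → Fin 3 → ℚ),
    (∀ i a b, t i (a + b) = t i a + B a *ᵥ t i b) ∧
    ∀ l ≠ 0, ∃ i, ∃ w : Fin 3 → ℚ, w ᵥ* B l = w ∧ w ⬝ᵥ t i l ≠ 0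

section

variable {p : ℕ}

lemma HasSeparatingCocycles.of_conj {B : (Fin p → ℤ) → Matrix (Fin 3) (Fin 3) ℚ}
    {P Q : Matrix (Fin 3) (Fin 3) ℚ} (hPQ : P * Q = 1)
    (h : HasSeparatingCocycles fun l => P * B l * Q) : HasSeparatingCocycles B := by
  have hQP : Q * P = 1 := mul_eq_one_comm.1 hPQ
  obtain ⟨ι, hι, t, ht, hs⟩ := h
  refine ⟨ι, hι, fun i l => Q *ᵥ t i l, fun i a b => ?_, fun l hl => ?_⟩
  · simp only [ht, mulVec_add, mulVec_mulVec, ← Matrix.mul_assoc, hQP, Matrix.one_mul]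
  · obtain ⟨i, w, hw, hwt⟩ := hs l hl
    refine ⟨i, w ᵥ* P, ?_, ?_⟩
    · have := congrArg (fun v => v ᵥ* P) hw
      simpa only [vecMul_vecMul, Matrix.mul_assoc, hQP, Matrix.mul_one] using this
    · rwa [← dotProduct_mulVec, mulVec_mulVec, hPQ, one_mulVec]

lemma exists_coord_ne_zero {l : Fin p → ℤ} (hl : l ≠ 0) : ∃ i, (l i : ℚ) ≠ 0 := by
  obtain ⟨i, hi⟩ := Function.ne_iff.1 hl
  exact ⟨i, by exact_mod_cast hi⟩

/-- The cocycle `(c(c-1)/2, 0, c)` works because the binomial coefficient of a sum acquires the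
cross term `c m * c n`, just what the matrix adds. Where `c` vanishes, the first coordinate covector
is fixed and the cocycles `(l j, 0, 0)` separate. -/
lemma hasSeparatingCocycles_of_split {χ c : (Fin p → ℤ) → ℚ}
    (hc : ∀ m n, c (m + n) = c m + c n) :
    HasSeparatingCocycles fun l => !![1, 0, c l; 0, χ l, 0; 0, 0, 1] := by
  refine ⟨Option (Fin p), inferInstance,
    fun i l => i.elim ![c l * (c l - 1) / 2, 0, c l] fun j => ![(l j : ℚ), 0, 0],
    fun i m n => ?_, fun l hl => ?_⟩
  · cases i <;> ext j <;> fin_cases j <;>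
      simp [hc]
    ring
  · by_cases h : c l = 0
    · obtain ⟨j, hj⟩ := exists_coord_ne_zero hl
      refine ⟨some j, ![1, 0, 0], ?_, by simpa [dotProduct, Fin.sum_univ_three] using hj⟩
      ext i; fin_cases i <;> simp [vecMul, dotProduct, Fin.sum_univ_three, h]
    · refine ⟨none, ![0, 0, 1], ?_, by simpa [dotProduct, Fin.sum_univ_three] using h⟩
      ext i; fin_cases i <;> simp [vecMul, dotProduct, Fin.sum_univ_three]

lemma hasSeparatingCocycles_of_translations {b c : (Fin p → ℤ) → ℚ} :
    HasSeparatingCocycles fun l => !![1, 0, c l; 0, 1, b l; 0, 0, 1] := by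
  refine ⟨Fin p ⊕ Fin p, inferInstance,
    fun i l => i.elim (fun j => ![(l j : ℚ), 0, 0]) fun j => ![0, (l j : ℚ), 0],
    fun i m n => ?_, fun l hl => ?_⟩
  · cases i <;> ext j <;> fin_cases j <;>
      simp
  · obtain ⟨j, hj⟩ := exists_coord_ne_zero hl
    by_cases h : b l = 0
    · refine ⟨.inr j, ![0, 1, 0], ?_, by simpa [dotProduct, Fin.sum_univ_three] using hj⟩
      ext i; fin_cases i <;> simp [vecMul, dotProduct, Fin.sum_univ_three, h]
    -- A covector `(x, y, 0)` is fixed exactly when `x * c l + y * b l = 0`.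
    · refine ⟨.inl j, ![b l, -c l, 0], ?_, ?_⟩
      · ext i; fin_cases i <;> simp [vecMul, dotProduct, Fin.sum_univ_three]
        ring
      · simpa [dotProduct, Fin.sum_univ_three] using ⟨h, by exact_mod_cast hj⟩

/-- The vector `(a c - r a³ / 3, c, a)` is a cocycle: the correction `r a³ / 3` absorbs the terms `r
(a m² a n + a m a n²)` arising from `a c`. The three alternatives `a ≠ 0`, `a = 0 ≠ c` and `a = c =
0` leave the third, second and first coordinate covectors fixed. -/
lemma hasSeparatingCocycles_of_unipotent {a c : (Fin p → ℤ) → ℚ} {r : ℚ}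
    (ha : ∀ m n, a (m + n) = a m + a n) (hc : ∀ m n, c (m + n) = c m + c n + r * a m * a n) :
    HasSeparatingCocycles fun l => !![1, a l, c l; 0, 1, r * a l; 0, 0, 1] := by
  refine ⟨Option (Fin p), inferInstance,
    fun i l => i.elim ![a l * c l - r * a l ^ 3 / 3, c l, a l] fun j => ![(l j : ℚ), 0, 0],
    fun i m n => ?_, fun l hl => ?_⟩
  · cases i <;> ext j <;> fin_cases j <;>
      simp [hc, ha] <;> ring
  · by_cases h : a l = 0
    · by_cases h' : c l = 0
      · obtain ⟨j, hj⟩ := exists_coord_ne_zero hl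
        refine ⟨some j, ![1, 0, 0], ?_, by simpa [dotProduct, Fin.sum_univ_three] using hj⟩
        ext i; fin_cases i <;> simp [vecMul, dotProduct, Fin.sum_univ_three, h, h']
      · refine ⟨none, ![0, 1, 0], ?_, by simpa [dotProduct, Fin.sum_univ_three] using h'⟩
        ext i; fin_cases i <;> simp [vecMul, dotProduct, Fin.sum_univ_three, h]
    · refine ⟨none, ![0, 0, 1], ?_, by simpa [dotProduct, Fin.sum_univ_three] using h⟩
      ext i; fin_cases i <;> simp [vecMul, dotProduct, Fin.sum_univ_three]

/-- Everything follows from expanding the entries of `l = m + n` in both orders. If `χ` is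
nontrivial, `a` and `b` are multiples of `1 - χ` and a conjugation removes them. If `χ = 1`,
comparing the two values of `c` gives `a m * b n = a n * b m`, so `a = 0` or `b` is proportional to
`a`. -/
lemma hasSeparatingCocycles_of_triangular {a b c χ : (Fin p → ℤ) → ℚ}
    (ha : ∀ m n, a (m + n) = a n + a m * χ n) (hχ : ∀ m n, χ (m + n) = χ m * χ n)
    (hb : ∀ m n, b (m + n) = χ m * b n + b m)
    (hc : ∀ m n, c (m + n) = c n + a m * b n + c m) :
    HasSeparatingCocycles fun l => !![1, a l, c l; 0, χ l, b l; 0, 0, 1] := by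
  by_cases h : ∀ m, χ m = 1
  · simp only [h, mul_one, one_mul] at ha hb ⊢
    by_cases h0 : ∀ m, a m = 0
    · simp only [h0]
      exact hasSeparatingCocycles_of_translations
    · obtain ⟨n, hn⟩ := not_forall.1 h0
      have hab (m) : b m = b n / a n * a m := by
        have h1 := hc m n
        rw [add_comm m n, hc n m] at h1
        field_simp
        linarith
      have := hasSeparatingCocycles_of_unipotent (a := a) (c := c) (r := b n / a n)
        (fun m n => by rw [ha]; ring) (fun m k => by rw [hc, hab k]; ring)
      simpa only [← hab] using this
  · obtain ⟨n, hn⟩ := not_forall.1 h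
    have hn' : 1 - χ n ≠ 0 := sub_ne_zero.2 (Ne.symm hn)
    have ha' (m) : a m = a n / (1 - χ n) * (1 - χ m) := by
      have h1 := ha m n
      rw [add_comm m n, ha n m] at h1
      field_simp
      linarith
    have hb' (m) : b m = b n / (1 - χ n) * (1 - χ m) := by
      have h1 := hb m n
      rw [add_comm m n, hb n m] at h1
      field_simp
      linarith
    generalize a n / (1 - χ n) = x at ha'
    generalize b n / (1 - χ n) = y at hb'
    refine HasSeparatingCocycles.of_conj (P := !![1, x, 0; 0, 1, -y; 0, 0, 1])
      (Q := !![1, -x, -x * y; 0, 1, y; 0, 0, 1]) ?_ ?_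
    · ext i j; fin_cases i <;> fin_cases j <;> simp [mul_apply, Fin.sum_univ_three]
    · have := hasSeparatingCocycles_of_split (χ := χ)
        (c := fun m => c m + x * y * (1 - χ m)) (fun m n => by
          simp only [hc, hχ, ha' m, hb' n]; ring)
      convert this using 2 with l
      ext i j; fin_cases i <;> fin_cases j <;>
        simp [mul_apply, Fin.sum_univ_three, ha' l, hb' l] <;> ring

/-- If `w` does not vanish on `v`, the multiples `l i • v` already separate. Otherwise `v` and `w`
together put the action into triangular form. -/
lemma hasSeparatingCocycles_of_fixed {B : (Fin p → ℤ) → Matrix (Fin 3) (Fin 3) ℚ}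
    (B_add : ∀ a b, B (a + b) = B a * B b) {v w : Fin 3 → ℚ} (hv0 : v ≠ 0) (hw0 : w ≠ 0)
    (hv : ∀ l, B l *ᵥ v = v) (hw : ∀ l, w ᵥ* B l = w) : HasSeparatingCocycles B := by
  by_cases hwv : w ⬝ᵥ v = 0
  · have hvv : v ⬝ᵥ v ≠ 0 := fun h => hv0 (dotProduct_self_eq_zero.1 h)
    have hww : w ⬝ᵥ w ≠ 0 := fun h => hw0 (dotProduct_self_eq_zero.1 h)
    -- The rows are `v`, the cross product of `v` and `w`, and `w`. For `w ⬝ᵥ v = 0` they are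
    -- orthogonal; `P` sends `v` to a multiple of the first basis vector and `w` is its last row.
    let P : Matrix (Fin 3) (Fin 3) ℚ := !![v 0, v 1, v 2;
      v 1 * w 2 - v 2 * w 1, v 2 * w 0 - v 0 * w 2, v 0 * w 1 - v 1 * w 0; w 0, w 1, w 2]
    have hdet : P.det ≠ 0 := by
      have : P.det = (w ⬝ᵥ v) ^ 2 - (v ⬝ᵥ v) * (w ⬝ᵥ w) := by
        simp [P, det_fin_three, dotProduct, Fin.sum_univ_three]
        ring
      rw [this, hwv]
      simp [hvv, hww]
    have hPQ : P * P⁻¹ = 1 := mul_nonsing_inv _ (isUnit_iff_ne_zero.2 hdet)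
    have hQP : P⁻¹ * P = 1 := nonsing_inv_mul _ (isUnit_iff_ne_zero.2 hdet)
    have hPv : P *ᵥ v = Pi.single 0 (v ⬝ᵥ v) := by
      ext i
      fin_cases i <;> simp [P, mulVec, dotProduct, Fin.sum_univ_three]
      · ring
      · rw [← hwv]; simp [dotProduct, Fin.sum_univ_three]
    have hPw : Pi.single 2 1 ᵥ* P = w := by
      ext i
      fin_cases i <;> simp [P]
    refine HasSeparatingCocycles.of_conj hPQ ?_
    let D (l : Fin p → ℤ) := P * B l * P⁻¹
    have hD0 (l) (i) : D l i 0 = (Pi.single 0 1 : Fin 3 → ℚ) i := by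
      have h1 : D l *ᵥ (P *ᵥ v) = P *ᵥ v := by
        simp only [D, mulVec_mulVec, Matrix.mul_assoc, hQP, Matrix.mul_one]
        rw [← mulVec_mulVec, hv]
      rw [hPv] at h1
      have h2 := congrFun h1 i
      rw [mulVec_single] at h2
      have h3 : (Pi.single 0 (v ⬝ᵥ v) : Fin 3 → ℚ) i =
        (Pi.single 0 1 : Fin 3 → ℚ) i * (v ⬝ᵥ v) := by fin_cases i <;> simp
      rw [h3] at h2
      exact mul_right_cancel₀ hvv h2
    have hD2 (l) (j) : D l 2 j = (Pi.single 2 1 : Fin 3 → ℚ) j := by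
      have h1 : Pi.single 2 1 ᵥ* D l = Pi.single 2 1 := by
        have : Pi.single 2 1 = w ᵥ* P⁻¹ := by rw [← hPw, vecMul_vecMul, hPQ, vecMul_one]
        simp only [D, ← vecMul_vecMul, hPw, hw]
        exact this.symm
      have h2 := congrFun h1 j
      simpa using h2
    have hD_add (m n) : D (m + n) = D m * D n := by
      simp only [D, B_add, Matrix.mul_assoc]
      rw [← Matrix.mul_assoc P⁻¹ P, hQP, Matrix.one_mul]
    have hDe (l) : D l = !![1, D l 0 1, D l 0 2; 0, D l 1 1, D l 1 2; 0, 0, 1] := by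
      ext i j
      fin_cases i <;> fin_cases j <;> simp [hD0, hD2]
    have hmul (m n) (i j) : D (m + n) i j = ∑ k, D m i k * D n k j := by
      rw [hD_add, mul_apply]
    have := hasSeparatingCocycles_of_triangular (p := p) (a := fun l => D l 0 1)
      (b := fun l => D l 1 2) (c := fun l => D l 0 2) (χ := fun l => D l 1 1)
      (fun m n => by simp [hmul, Fin.sum_univ_three, hD0, hD2])
      (fun m n => by simp [hmul, Fin.sum_univ_three, hD0, hD2])
      (fun m n => by simp [hmul, Fin.sum_univ_three, hD0, hD2])
      (fun m n => by simp [hmul, Fin.sum_univ_three, hD0, hD2])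
    simp only [← hDe] at this
    exact this
  · refine ⟨Fin p, inferInstance, fun i l => (l i : ℚ) • v, fun i a b => ?_, fun l hl => ?_⟩
    · simp [mulVec_smul, hv, add_smul]
    · obtain ⟨i, hi⟩ := exists_coord_ne_zero hl
      exact ⟨i, w, hw l, by rw [dotProduct_smul, smul_eq_mul]; exact mul_ne_zero hi hwv⟩

end

/-! ### Spectrally unitary actions on `ℚ³` -/

/-- Induction on `finrank W`: if some `f i` is not scalar on `W`, one of its eigenspaces in `W` is
proper, nonzero and, by commutation, invariant. -/
lemma exists_common_eigenvector {K V ι : Type*} [Field K] [IsAlgClosed K] [AddCommGroup V]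
    [Module K V] [FiniteDimensional K V] (f : ι → Module.End K V)
    (hf : ∀ i j, Commute (f i) (f j)) (W : Submodule K V) (hW : W ≠ ⊥)
    (hWf : ∀ i, ∀ x ∈ W, f i x ∈ W) :
    ∃ v ∈ W, v ≠ 0 ∧ ∃ χ : ι → K, ∀ i, f i v = χ i • v := by
  induction h : Module.finrank K W using Nat.strong_induction_on generalizing W with
  | _ n ih =>
  subst h
  by_cases hs : ∀ i, ∃ μ : K, ∀ x ∈ W, f i x = μ • x
  · choose χ hχ using hs
    obtain ⟨v, hv, hv0⟩ := W.ne_bot_iff.1 hW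
    exact ⟨v, hv, hv0, χ, fun i => hχ i v hv⟩
  · obtain ⟨i, hi⟩ := not_forall.1 hs
    have : Nontrivial W := Submodule.nontrivial_iff_ne_bot.2 hW
    obtain ⟨μ, hμ⟩ := Module.End.exists_eigenvalue ((f i).restrict (hWf i))
    obtain ⟨v, hv⟩ := hμ.exists_hasEigenvector
    have hv1 : f i v = μ • (v : V) := congrArg Subtype.val hv.apply_eq_smul
    let U := W ⊓ Module.End.eigenspace (f i) μ
    have hUW : U < W := by
      refine lt_of_le_of_ne inf_le_left fun h => hi ⟨μ, fun x hx => ?_⟩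
      rw [← h] at hx
      exact Module.End.mem_eigenspace_iff.1 hx.2
    have hU0 : U ≠ ⊥ := by
      refine U.ne_bot_iff.2 ⟨v, ⟨v.2, Module.End.mem_eigenspace_iff.2 hv1⟩, fun h => hv.2 ?_⟩
      exact Subtype.ext h
    obtain ⟨w, hw, h⟩ := ih _ (Submodule.finrank_lt_finrank_of_lt hUW) U hU0
      (fun j x hx => ⟨hWf j x hx.1, Module.End.mem_eigenspace_iff.2 (by
        rw [← Module.End.mul_apply, (hf i j).eq, Module.End.mul_apply,
          Module.End.mem_eigenspace_iff.1 hx.2, map_smul])⟩) rfl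
    exact ⟨w, hw.1, h⟩

/-- Simultaneous generalized eigenspaces for distinct characters are independent. -/
lemma card_common_eigenvalues_le {K V ι : Type*} [Field K] [AddCommGroup V]
    [Module K V] [FiniteDimensional K V] (f : ι → Module.End K V)
    (hf : ∀ i j, Commute (f i) (f j)) {κ : Type*} [Fintype κ] (χ : κ → ι → K)
    (hχ : Function.Injective χ) (h : ∀ k, ∃ v ≠ 0, ∀ i, f i v = χ k i • v) :
    Fintype.card κ ≤ Module.finrank K V := by
  choose v hv0 hv using h
  have hind : iSupIndep fun k => ⨅ i, (f i).maxGenEigenspace (χ k i) :=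
    (Module.End.independent_iInf_maxGenEigenspace_of_forall_mapsTo f
      fun i j φ => Module.End.mapsTo_maxGenEigenspace_of_comm (hf j i) φ).comp hχ
  have hmem (k) : v k ∈ ⨅ i, (f i).maxGenEigenspace (χ k i) := by
    rw [Module.End.mem_iInf_maxGenEigenspace_iff]
    exact fun i => ⟨1, by simp [hv k i]⟩
  exact (hind.linearIndependent _ hmem hv0).fintype_card_le_finrank

/-! ### Abelian groups covered by kernels of characters -/

section Characters

variable {G K : Type*} [AddCommGroup G] [Field K]

/-- A group is not the union of two proper subgroups. -/
lemma exists_both_ne_one {χ ψ : G → K} (hχ : ∀ a b, χ (a + b) = χ a * χ b)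
    (hψ : ∀ a b, ψ (a + b) = ψ a * ψ b) {a b : G} (ha : χ a ≠ 1) (hb : ψ b ≠ 1) :
    ∃ x, χ x ≠ 1 ∧ ψ x ≠ 1 := by
  by_cases h1 : ψ a = 1
  · by_cases h2 : χ b = 1
    · exact ⟨a + b, by rwa [hχ, h2, mul_one], by rwa [hψ, h1, one_mul]⟩
    · exact ⟨b, h2, hb⟩
  · exact ⟨a, ha, h1⟩

/-- Three characters of an abelian group, all of them nontrivial, whose kernels cover the group,
are the three nontrivial characters of a quotient isomorphic to the Klein four-group. -/
lemma klein_of_cover {χ : Fin 3 → G → K} (hmul : ∀ i a b, χ i (a + b) = χ i a * χ i b)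
    (hne : ∀ i, ∃ a, χ i a ≠ 1) (hcov : ∀ a, ∃ i, χ i a = 1) :
    (∃ g h, χ 0 g = 1 ∧ χ 1 g = -1 ∧ χ 0 h = -1 ∧ χ 1 h = 1) ∧
    ∀ a, (χ 0 a = 1 ∨ χ 0 a = -1) ∧ (χ 1 a = 1 ∨ χ 1 a = -1) ∧ χ 2 a = χ 0 a * χ 1 a := by
  have hcov' (a) : χ 0 a = 1 ∨ χ 1 a = 1 ∨ χ 2 a = 1 := by
    obtain ⟨i, hi⟩ := hcov a
    fin_cases i <;> simp_all
  obtain ⟨a0, h0⟩ := hne 0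
  obtain ⟨a1, h1⟩ := hne 1
  obtain ⟨a2, h2⟩ := hne 2
  -- Elements outside two of the kernels lie in the third. Applied to `g + h`, `2g + h`, `g + 2h`
  -- and `g - h`, this determines all values at `g` and `h`.
  obtain ⟨g, hg1, hg2⟩ := exists_both_ne_one (hmul 1) (hmul 2) h1 h2
  obtain ⟨h, hh0, hh2⟩ := exists_both_ne_one (hmul 0) (hmul 2) h0 h2
  have hg0 : χ 0 g = 1 := by have := hcov' g; tauto
  have hh1 : χ 1 h = 1 := by have := hcov' h; tauto
  have e1 : χ 2 g * χ 2 h = 1 := by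
    have := hcov' (g + h)
    simp only [hmul, hg0, hh1, one_mul, mul_one] at this
    tauto
  have eg1 : χ 1 g = -1 := by
    have := hcov' (g + (g + h))
    simp only [hmul, hg0, hh1, one_mul, mul_one, e1] at this
    have : χ 1 g * χ 1 g = 1 := by tauto
    exact (mul_self_eq_one_iff.1 this).resolve_left hg1
  have eh0 : χ 0 h = -1 := by
    have := hcov' (h + (g + h))
    simp only [hmul, hg0, hh1, one_mul, mul_one, e1] at this
    have : χ 0 h * χ 0 h = 1 := by tauto
    exact (mul_self_eq_one_iff.1 this).resolve_left hh0
  have eg2 : χ 2 g = -1 := by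
    have hz : χ 0 0 = 1 := by
      have := hmul 0 g 0
      rw [add_zero, hg0, one_mul] at this
      exact this.symm
    have hn0 : χ 0 h * χ 0 (-h) = 1 := by rw [← hmul, add_neg_cancel, hz]
    have hn1 : χ 1 (-h) = 1 := by
      have h1 := hmul 1 h (-h)
      have h2 := hmul 1 h 0
      rw [add_zero, hh1, one_mul] at h2
      rw [add_neg_cancel, hh1, one_mul, ← h2] at h1
      exact h1.symm
    have hn2 : χ 2 (-h) = χ 2 g := by
      have h0 : χ 2 h ≠ 0 := right_ne_zero_of_mul_eq_one e1
      have h1 := hmul 2 h (-h)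
      have h2 := hmul 2 h 0
      rw [add_zero] at h2
      have h3 : χ 2 0 = 1 := mul_left_cancel₀ h0 (by rw [← h2, mul_one])
      rw [add_neg_cancel, h3, ← e1, mul_comm] at h1
      exact (mul_left_cancel₀ h0 h1.symm)
    have := hcov' (g + -h)
    simp only [hmul, hg0, hn1, one_mul, mul_one, hn2] at this
    have h5 : χ 0 (-h) ≠ 1 := fun h => hh0 (by rwa [h, mul_one] at hn0)
    have : χ 2 g * χ 2 g = 1 := by tauto
    exact (mul_self_eq_one_iff.1 this).resolve_left hg2
  have eh2 : χ 2 h = -1 := by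
    rw [eg2] at e1
    linear_combination -e1
  refine ⟨⟨g, h, hg0, eg1, eh0, hh1⟩, fun a => ?_⟩
  -- The same covering condition on the coset of `a` under the subgroup generated by `g` and `h`
  -- determines the values at `a`.
  have c1 := hcov' a
  have c2 := hcov' (a + g)
  have c3 := hcov' (a + h)
  have c4 := hcov' (a + (g + h))
  simp only [hmul, hg0, hh1, eg1, eh0, eg2, eh2, mul_one, mul_neg, neg_neg,
    neg_eq_iff_eq_neg] at c1 c2 c3 c4
  have hdist : (1 : K) ≠ -1 := fun h => hg1 (eg1.trans h.symm)
  by_cases ha : χ 0 a = 1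
  · simp only [ha, hdist, false_or, true_or, true_and, one_mul] at c1 c2 c3 c4 ⊢
    rcases c3 with c3 | c3 <;> rcases c4 with c4 | c4
    · exact absurd (c3.symm.trans c4) hdist
    · exact ⟨.inl c3, c4.trans c3.symm⟩
    · exact ⟨.inr c4, c3.trans c4.symm⟩
    · exact absurd (c4.symm.trans c3) hdist
  · simp only [ha, false_or] at c1 c2 c3 c4 ⊢
    rcases c1 with c1 | c1 <;> rcases c2 with c2 | c2
    · exact absurd (c1.symm.trans c2) hdist
    · simp only [c1, c2, hdist, hdist.symm, or_false] at c4 ⊢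
      simp [c4]
    · simp only [c1, c2, hdist, hdist.symm, false_or, or_false] at c3 ⊢
      simp [c3]
    · exact absurd (c1.symm.trans c2) hdist

end Characters

/-- Since `ℤᵖ` is free, exponents may be chosen on a basis. Integer exponents are wanted, not
parities, because they become powers of diffeomorphisms that need not be involutions. -/
lemma exists_parity_hom {p : ℕ} {χ : (Fin p → ℤ) → ℚ} (hmul : ∀ a b, χ (a + b) = χ a * χ b)
    (hχ : ∀ a, χ a = 1 ∨ χ a = -1) :
    ∃ n : (Fin p → ℤ) →+ ℤ, ∀ a, χ a = (-1) ^ n a := by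
  classical
  have h0 : χ 0 = 1 := by
    have := hmul 0 0
    rw [add_zero] at this
    rcases hχ 0 with h | h
    · exact h
    · rw [h] at this; norm_num at this
  let u : Multiplicative (Fin p → ℤ) →* ℚˣ := MonoidHom.toHomUnits
    { toFun := fun a => χ a.toAdd
      map_one' := h0
      map_mul' := fun a b => hmul _ _ }
  let s (i : Fin p) : ℤ := if χ (Pi.single i 1) = 1 then 0 else 1
  let n : (Fin p → ℤ) →+ ℤ := AddMonoidHom.mk' (fun l => ∑ i, s i * l i) fun a b => by
    simp [mul_add, Finset.sum_add_distrib]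
  have key : MonoidHom.toAdditiveRight u =
      (MonoidHom.toAdditiveRight (zpowersHom ℚˣ (-1))).comp n := by
    refine AddMonoidHom.functions_ext' _ _ _ fun i => ?_
    ext
    have h1 : n (Pi.single i 1) = s i := by simp [n, Pi.single_apply]
    change χ (Pi.single i 1) = (((-1 : ℚˣ) ^ n (Pi.single i 1) : ℚˣ) : ℚ)
    rw [h1]
    by_cases h : χ (Pi.single i 1) = 1
    · simp [s, h]
    · rw [show s i = 1 from if_neg h, (hχ _).resolve_left h]
      simp
  refine ⟨n, fun a => ?_⟩
  have h1 := DFunLike.congr_fun key a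
  have h2 := congrArg (fun x : Additive ℚˣ => ((x.toMul : ℚˣ) : ℚ)) h1
  change χ a = (((-1 : ℚˣ) ^ n a : ℚˣ) : ℚ) at h2
  rw [h2]
  simp

/-- A `ℚ`-linear functional on `ℂ`, applied to each coordinate, preserves the eigenvector equations
since entries and eigenvalues are rational. It is chosen nonzero on a nonzero coordinate. -/
lemma exists_rational_eigenvector {ι : Type*} (B : ι → Matrix (Fin 3) (Fin 3) ℚ) (χ : ι → ℚ)
    (h : ∃ v : Fin 3 → ℂ, v ≠ 0 ∧ ∀ l, (B l).map (Rat.cast : ℚ → ℂ) *ᵥ v = (χ l : ℂ) • v) :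
    ∃ v : Fin 3 → ℚ, v ≠ 0 ∧ ∀ l, B l *ᵥ v = χ l • v := by
  obtain ⟨v, hv0, hv⟩ := h
  obtain ⟨i, hi⟩ := Function.ne_iff.1 hv0
  obtain ⟨φ, hφ⟩ : ∃ φ : Module.Dual ℚ ℂ, φ (v i) ≠ 0 := by
    by_contra! h
    exact hi ((Module.forall_dual_apply_eq_zero_iff ℚ (v i)).1 h)
  refine ⟨fun j => φ (v j), Function.ne_iff.2 ⟨i, hφ⟩, fun l => ?_⟩
  ext j
  have := congrArg φ (congrFun (hv l) j)
  simp only [mulVec, dotProduct, Fin.sum_univ_three, map_apply, Pi.smul_apply, smul_eq_mul,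
    ← Rat.smul_def, map_add, map_smul] at this ⊢
  exact this

theorem exists_fixed_or_klein {p : ℕ} (B : (Fin p → ℤ) → Matrix (Fin 3) (Fin 3) ℚ)
    (B_add : ∀ a b, B (a + b) = B a * B b)
    (hB : ∀ l, (B l - 1).det = 0) :
    (∃ v : Fin 3 → ℚ, v ≠ 0 ∧ ∀ l, B l *ᵥ v = v) ∨
    ∃ (n₁ n₂ : (Fin p → ℤ) →+ ℤ) (v : Fin 3 → Fin 3 → ℚ),
      (∃ g h, Odd (n₁ g) ∧ Even (n₂ g) ∧ Even (n₁ h) ∧ Odd (n₂ h)) ∧ (∀ i, v i ≠ 0) ∧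
      ∀ l, B l *ᵥ v 0 = (-1 : ℚ) ^ n₂ l • v 0 ∧ B l *ᵥ v 1 = (-1 : ℚ) ^ n₁ l • v 1 ∧
        B l *ᵥ v 2 = (-1 : ℚ) ^ (n₁ l + n₂ l) • v 2 := by
  let C (l : Fin p → ℤ) : Matrix (Fin 3) (Fin 3) ℂ := (B l).map (Rat.cast : ℚ → ℂ)
  let f (l : Fin p → ℤ) : Module.End ℂ (Fin 3 → ℂ) := Matrix.toLin' (C l)
  have C_add (a b) : C (a + b) = C a * C b := by
    simp only [C, B_add]
    exact Matrix.map_mul (f := Rat.castHom ℂ)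
  have f_comm (a b) : Commute (f a) (f b) := by
    change f a * f b = f b * f a
    rw [Module.End.mul_eq_comp, Module.End.mul_eq_comp, ← Matrix.toLin'_mul,
      ← Matrix.toLin'_mul, ← C_add, ← C_add, add_comm]
  let S : Set ((Fin p → ℤ) → ℂ) := {χ | ∃ v ≠ 0, ∀ l, f l v = χ l • v}
  have S_mul {χ} (hχ : χ ∈ S) (a b) : χ (a + b) = χ a * χ b := by
    obtain ⟨v, hv0, hv⟩ := hχ
    have : χ (a + b) • v = (χ a * χ b) • v := by
      rw [← hv, mul_comm, mul_smul, ← hv a, ← map_smul, ← hv b]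
      simp [f, C_add]
    exact smul_left_injective ℂ hv0 this
  have S_cov (l) : ∃ χ ∈ S, χ l = 1 := by
    have hdet : (C l - 1).det = 0 := by
      have : C l - 1 = (Rat.castHom ℂ).mapMatrix (B l - 1) := by
        rw [map_sub, map_one]; rfl
      rw [this, ← RingHom.map_det, hB, map_zero]
    obtain ⟨v, hv0, hv⟩ := Matrix.exists_mulVec_eq_zero_iff.2 hdet
    have hv1 : f l v = v := by
      rw [sub_mulVec, one_mulVec, sub_eq_zero] at hv
      simpa [f] using hv
    obtain ⟨w, hw, hw0, χ, hχ⟩ := exists_common_eigenvector f f_comm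
      (Module.End.eigenspace (f l) 1)
      (Submodule.ne_bot_iff _ |>.2 ⟨v, Module.End.mem_eigenspace_iff.2 (by simpa), hv0⟩)
      (fun j x hx => by
        rw [Module.End.mem_eigenspace_iff] at hx ⊢
        rw [← Module.End.mul_apply, (f_comm l j).eq, Module.End.mul_apply, hx, map_smul])
    refine ⟨χ, ⟨w, hw0, hχ⟩, smul_left_injective ℂ hw0 ?_⟩
    exact (hχ l).symm.trans (Module.End.mem_eigenspace_iff.1 hw)
  by_cases hS : ∀ χ ∈ S, ∃ a, χ a ≠ 1
  · right
    -- Each new character takes the value `1` where its predecessors do not, which gives three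
    -- distinct ones. An element outside their kernels would produce a fourth, too many for
    -- dimension three.
    obtain ⟨χ₁, h₁, -⟩ := S_cov 0
    obtain ⟨a, ha⟩ := hS _ h₁
    obtain ⟨χ₂, h₂, h₂a⟩ := S_cov a
    obtain ⟨b, hb⟩ := hS _ h₂
    obtain ⟨x, hx₁, hx₂⟩ := exists_both_ne_one (S_mul h₁) (S_mul h₂) ha hb
    obtain ⟨χ₃, h₃, h₃x⟩ := S_cov x
    have n12 : χ₁ ≠ χ₂ := fun h => ha (h ▸ h₂a)
    have n13 : χ₁ ≠ χ₃ := fun h => hx₁ (h ▸ h₃x)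
    have n23 : χ₂ ≠ χ₃ := fun h => hx₂ (h ▸ h₃x)
    have hcov (l) : ∃ i, (![χ₁, χ₂, χ₃] : Fin 3 → _) i l = 1 := by
      by_contra! h
      obtain ⟨χ, hχ, hχl⟩ := S_cov l
      have hc := card_common_eigenvalues_le f f_comm (κ := Fin 4) ![χ, χ₁, χ₂, χ₃]
        (by
          have m1 : χ ≠ χ₁ := fun e => h 0 (e ▸ hχl)
          have m2 : χ ≠ χ₂ := fun e => h 1 (e ▸ hχl)
          have m3 : χ ≠ χ₃ := fun e => h 2 (e ▸ hχl)
          intro i j hij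
          fin_cases i <;> fin_cases j <;> simp_all)
        (fun k => by fin_cases k; exacts [hχ, h₁, h₂, h₃])
      simp at hc
    have hmem (i) : (![χ₁, χ₂, χ₃] : Fin 3 → _) i ∈ S := by
      fin_cases i; exacts [h₁, h₂, h₃]
    obtain ⟨⟨g, h, hg1, hg2, hh1, hh2⟩, hall⟩ := klein_of_cover
      (fun i => S_mul (hmem i)) (fun i => hS _ (hmem i)) hcov
    simp only [cons_val_zero, cons_val_one, cons_val] at hg1 hg2 hh1 hh2 hall
    have lift {χ : (Fin p → ℤ) → ℂ} (hχ : χ ∈ S) (h : ∀ a, χ a = 1 ∨ χ a = -1) :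
        ∃ n : (Fin p → ℤ) →+ ℤ, ∀ a, χ a = (-1) ^ n a := by
      classical
      let ψ (a : Fin p → ℤ) : ℚ := if χ a = 1 then 1 else -1
      have hψ (a) : χ a = ψ a := by
        by_cases h' : χ a = 1
        · simp [ψ, h']
        · simp only [ψ, if_neg h']
          rw [(h a).resolve_left h']
          simp
      obtain ⟨n, hn⟩ := exists_parity_hom (χ := ψ)
        (fun a b => by
          have := S_mul hχ a b
          rw [hψ, hψ, hψ] at this
          exact_mod_cast this)
        (fun a => by
          by_cases h' : χ a = 1
          · simp [ψ, h']
          · simp [ψ, h'])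
      exact ⟨n, fun a => by rw [hψ, hn]; push_cast; rfl⟩
    obtain ⟨n₂, hn₂⟩ := lift h₁ fun a => (hall a).1
    obtain ⟨n₁, hn₁⟩ := lift h₂ fun a => (hall a).2.1
    have hn₃ (a) : χ₃ a = (-1) ^ (n₁ a + n₂ a) := by
      rw [(hall a).2.2, hn₁, hn₂, zpow_add₀ (by norm_num), mul_comm]
    have hvec {χ : (Fin p → ℤ) → ℂ} (hχ : χ ∈ S) {n : (Fin p → ℤ) → ℤ}
        (hn : ∀ a, χ a = (-1) ^ n a) :
        ∃ v : Fin 3 → ℚ, v ≠ 0 ∧ ∀ l, B l *ᵥ v = (-1 : ℚ) ^ n l • v := by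
      refine exists_rational_eigenvector B _ ?_
      obtain ⟨v, hv0, hv⟩ := hχ
      refine ⟨v, hv0, fun l => ?_⟩
      have := hv l
      rw [hn] at this
      push_cast
      simpa [f, C] using this
    obtain ⟨v₀, hv₀, hB₀⟩ := hvec h₁ hn₂
    obtain ⟨v₁, hv₁, hB₁⟩ := hvec h₂ hn₁
    obtain ⟨v₂, hv₂, hB₂⟩ := hvec h₃ (n := fun a => n₁ a + n₂ a) hn₃
    have hev {n : ℤ} (h : (-1 : ℂ) ^ n = 1) : Even n := by
      by_contra h'
      rw [(Int.not_even_iff_odd.1 h').neg_one_zpow] at h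
      norm_num at h
    have hod {n : ℤ} (h : (-1 : ℂ) ^ n = -1) : Odd n := by
      by_contra h'
      rw [(Int.not_odd_iff_even.1 h').neg_one_zpow] at h
      norm_num at h
    refine ⟨n₁, n₂, ![v₀, v₁, v₂], ⟨g, h, hod (by rw [← hn₁, hg2]), hev (by rw [← hn₂, hg1]),
      hev (by rw [← hn₁, hh2]), hod (by rw [← hn₂, hh1])⟩, fun i => ?_,
      fun l => ⟨hB₀ l, hB₁ l, hB₂ l⟩⟩
    fin_cases i; exacts [hv₀, hv₁, hv₂]
  · left
    push Not at hS
    obtain ⟨χ, ⟨v, hv0, hv⟩, hχ⟩ := hS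
    obtain ⟨w, hw0, hw⟩ := exists_rational_eigenvector B (fun _ => 1)
      ⟨v, hv0, fun l => by simpa [f, C, hχ] using hv l⟩
    exact ⟨w, hw0, fun l => by simpa using hw l⟩

/-! ### Klein actions on `ℤ³` -/

/-- Clear denominators and divide by the generator of the ideal of values; the vector `x` is a
Bézout relation. -/
lemma exists_primitive {w : Fin 3 → ℚ} (hw : w ≠ 0) :
    ∃ (q : ℚ) (w' x : Fin 3 → ℤ), q ≠ 0 ∧ (∀ i, q * w i = w' i) ∧ w' ⬝ᵥ x = 1 := by
  obtain ⟨N, hN⟩ := IsLocalization.exist_integer_multiples_of_finite (nonZeroDivisors ℤ) w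
  choose v hv using hN
  have hv' (i) : (v i : ℚ) = (N : ℤ) * w i := by simpa [Algebra.smul_def] using hv i
  have hN0 : ((N : ℤ) : ℚ) ≠ 0 := by exact_mod_cast nonZeroDivisors.coe_ne_zero N
  let f : (Fin 3 → ℤ) →ₗ[ℤ] ℤ := dotProductBilin ℤ ℤ v
  obtain ⟨g, hg⟩ := (IsPrincipalIdealRing.principal (LinearMap.range f)).principal
  obtain ⟨x, hx⟩ : g ∈ LinearMap.range f := hg ▸ Submodule.mem_span_singleton_self g
  have hdvd (i) : ∃ a, v i = g * a := by
    have : v i ∈ LinearMap.range f := ⟨Pi.single i 1, by simp [f]⟩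
    rw [hg, Submodule.mem_span_singleton] at this
    obtain ⟨a, ha⟩ := this
    exact ⟨a, by rw [← ha, smul_eq_mul, mul_comm]⟩
  choose a ha using hdvd
  have hg0 : g ≠ 0 := by
    rintro rfl
    refine hw (funext fun i => ?_)
    have := hv' i
    rw [ha i] at this
    simpa [hN0] using this
  have hgq : (g : ℚ) ≠ 0 := by exact_mod_cast hg0
  refine ⟨(N : ℤ) / g, a, x, div_ne_zero hN0 hgq, fun i => ?_, ?_⟩
  · have := hv' i
    rw [ha i] at this
    push_cast at this
    field_simp
    linarith
  · apply mul_left_cancel₀ hg0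
    have hx' : v ⬝ᵥ x = g := hx
    rw [mul_one, ← smul_eq_mul, ← smul_dotProduct, ← hx']
    congr 1
    ext i
    rw [ha i, hx']
    rfl

/-- The diagonal matrix through which a Klein action acts in suitable coordinates. -/
def kleinMat (m n : ℤ) : Matrix (Fin 3) (Fin 3) ℤ :=
  diagonal ![n.negOnePow, m.negOnePow, (m + n).negOnePow]

lemma kleinMat_add (m n m' n' : ℤ) :
    kleinMat (m + m') (n + n') = kleinMat m n * kleinMat m' n' := by
  rw [kleinMat, kleinMat, kleinMat, diagonal_mul_diagonal]
  congr 1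
  ext i
  fin_cases i <;> simp [Int.negOnePow_add]
  ring

lemma kleinMat_of_odd_even {m n : ℤ} (hm : Odd m) (hn : Even n) :
    kleinMat m n = diagonal ![1, -1, -1] := by
  simp [kleinMat, Int.negOnePow_even _ hn, Int.negOnePow_odd _ hm,
    Int.negOnePow_odd _ (hm.add_even hn)]

lemma kleinMat_of_even_odd {m n : ℤ} (hm : Even m) (hn : Odd n) :
    kleinMat m n = diagonal ![-1, 1, -1] := by
  simp [kleinMat, Int.negOnePow_even _ hm, Int.negOnePow_odd _ hn,
    Int.negOnePow_odd _ (hm.add_odd hn)]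

/-- The rows of `P` are primitive eigencovectors, but `P` need not be invertible over `ℤ`. The
vector `u` is what allows the two affine generators to commute modulo periods. -/
lemma exists_kleinMat_conj {G : Type*} {M : G → Matrix (Fin 3) (Fin 3) ℤ}
    {n₁ n₂ : G → ℤ} {w : Fin 3 → Fin 3 → ℚ} (hw0 : ∀ i, w i ≠ 0) {g h : G}
    (hg₁ : Odd (n₁ g)) (hg₂ : Even (n₂ g)) (hh₁ : Even (n₁ h)) (hh₂ : Odd (n₂ h))
    (hw : ∀ l, w 0 ᵥ* ratMat (M l) = (-1 : ℚ) ^ n₂ l • w 0 ∧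
      w 1 ᵥ* ratMat (M l) = (-1 : ℚ) ^ n₁ l • w 1 ∧
      w 2 ᵥ* ratMat (M l) = (-1 : ℚ) ^ (n₁ l + n₂ l) • w 2) :
    ∃ P : Matrix (Fin 3) (Fin 3) ℤ, P.det ≠ 0 ∧
      (∀ l, P * M l = kleinMat (n₁ l) (n₂ l) * P) ∧
      ∃ (u : Fin 3 → ℤ) (k : ℤ), P *ᵥ u = ![1, -1, k] := by
  choose q P x hq hqP hPx using fun i => exists_primitive (hw0 i)
  have hrow (i : Fin 3) (l : G) {n : ℤ} (h : w i ᵥ* ratMat (M l) = (-1 : ℚ) ^ n • w i) :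
      P i ᵥ* M l = (n.negOnePow : ℤ) • P i := by
    ext j
    have h1 := congrFun h j
    simp only [vecMul, dotProduct, Fin.sum_univ_three, map_apply, Pi.smul_apply,
      smul_eq_mul] at h1 ⊢
    have h2 : (P i 0 * M l 0 j + P i 1 * M l 1 j + P i 2 * M l 2 j : ℚ) =
        (-1 : ℚ) ^ n * P i j := by
      simp only [← hqP]
      linear_combination q i * h1
    rw [← Int.cast_negOnePow ℚ n] at h2
    exact_mod_cast h2
  have hPM (l) : Matrix.of P * M l = kleinMat (n₁ l) (n₂ l) * Matrix.of P := by
    ext i j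
    rw [kleinMat, diagonal_mul]
    obtain ⟨h0, h1, h2⟩ := hw l
    fin_cases i
    · exact congrFun (hrow 0 l h0) j
    · exact congrFun (hrow 1 l h1) j
    · exact congrFun (hrow 2 l h2) j
  have hPg := hPM g
  have hPh := hPM h
  rw [kleinMat_of_odd_even hg₁ hg₂] at hPg
  rw [kleinMat_of_even_odd hh₁ hh₂] at hPh
  have hP0 (i) : P i ≠ 0 := fun h0 => by
    have := hPx i
    rw [h0] at this
    simp at this
  refine ⟨Matrix.of P, fun hdet => ?_, hPM, ?_⟩
  -- A linear relation among the rows, transformed by the sign patterns of `g` and `h`, splits into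
  -- its three terms.
  · obtain ⟨c, hc0, hc⟩ := Matrix.exists_vecMul_eq_zero_iff.2 hdet
    have key (d : Fin 3 → ℤ) (A : Matrix (Fin 3) (Fin 3) ℤ)
        (hA : Matrix.of P * A = diagonal d * Matrix.of P) (j) :
        c 0 * d 0 * P 0 j + c 1 * d 1 * P 1 j + c 2 * d 2 * P 2 j = 0 := by
      have h1 : c ᵥ* (diagonal d * Matrix.of P) = 0 := by
        rw [← hA, ← vecMul_vecMul, hc, zero_vecMul]
      rw [← vecMul_vecMul] at h1
      simpa [vecMul, dotProduct, Fin.sum_univ_three, diagonal_apply] using congrFun h1 j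
    have k1 (j) : c 0 * P 0 j + c 1 * P 1 j + c 2 * P 2 j = 0 := by
      simpa [vecMul, dotProduct, Fin.sum_univ_three] using congrFun hc j
    have kg := key _ _ hPg
    have kh := key _ _ hPh
    simp only [cons_val_zero, cons_val_one, cons_val, mul_one, mul_neg] at kg kh
    have z (i) (h : ∀ j, c i * P i j = 0) : c i = 0 := by
      obtain ⟨j, hj⟩ := Function.ne_iff.1 (hP0 i)
      exact (mul_eq_zero.1 (h j)).resolve_right hj
    have c0 : c 0 = 0 := z 0 fun j => by linarith [k1 j, kg j]
    have c1 : c 1 = 0 := z 1 fun j => by linarith [k1 j, kh j]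
    have c2 : c 2 = 0 := z 2 fun j => by linarith [k1 j, kg j, kh j]
    exact hc0 (by ext i; fin_cases i <;> assumption)
  -- Symmetrizing `x 0` under `g` and `x 1` under `h` puts `(2, 0)` and `(0, 2)` into the image of
  -- `(P 0, P 1)` in `ℤ²`. That image also contains `(1, *)` and `(*, 1)`, hence `(1, -1)` by a
  -- parity check.
  · have hX : P 0 ⬝ᵥ (x 0 + M g *ᵥ x 0) = 2 ∧ P 1 ⬝ᵥ (x 0 + M g *ᵥ x 0) = 0 := by
      have e (i) : P i ⬝ᵥ (M g *ᵥ x 0) = (![1, -1, -1] : Fin 3 → ℤ) i * (P i ⬝ᵥ x 0) := by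
        rw [dotProduct_mulVec]
        have : P i ᵥ* M g = (![1, -1, -1] : Fin 3 → ℤ) i • P i := by
          ext j
          have := congrFun (congrFun hPg i) j
          rwa [diagonal_mul] at this
        rw [this, smul_dotProduct, smul_eq_mul]
      simp only [dotProduct_add, e]
      simp [hPx]
    have hY : P 0 ⬝ᵥ (x 1 + M h *ᵥ x 1) = 0 ∧ P 1 ⬝ᵥ (x 1 + M h *ᵥ x 1) = 2 := by
      have e (i) : P i ⬝ᵥ (M h *ᵥ x 1) = (![-1, 1, -1] : Fin 3 → ℤ) i * (P i ⬝ᵥ x 1) := by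
        rw [dotProduct_mulVec]
        have : P i ᵥ* M h = (![-1, 1, -1] : Fin 3 → ℤ) i • P i := by
          ext j
          have := congrFun (congrFun hPh i) j
          rwa [diagonal_mul] at this
        rw [this, smul_dotProduct, smul_eq_mul]
      simp only [dotProduct_add, e]
      simp [hPx]
    generalize x 0 + M g *ᵥ x 0 = X at hX
    generalize x 1 + M h *ᵥ x 1 = Y at hY
    suffices ∃ u, P 0 ⬝ᵥ u = 1 ∧ P 1 ⬝ᵥ u = -1 by
      obtain ⟨u, h0, h1⟩ := this
      refine ⟨u, P 2 ⬝ᵥ u, ?_⟩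
      ext i
      fin_cases i
      exacts [h0, h1, rfl]
    rcases Int.even_or_odd' (P 1 ⬝ᵥ x 0) with ⟨s, hs | hs⟩
    · rcases Int.even_or_odd' (P 0 ⬝ᵥ x 1) with ⟨r, hr | hr⟩
      · refine ⟨x 0 - x 1 + r • X - s • Y, ?_, ?_⟩ <;>
          simp only [dotProduct_add, dotProduct_sub, dotProduct_smul, hX, hY, hs, hr, hPx,
            smul_eq_mul] <;> ring
      · refine ⟨(r + 1) • X - x 1, ?_, ?_⟩ <;>
          simp only [dotProduct_sub, dotProduct_smul, hX, hr, hPx,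
            smul_eq_mul] <;> ring
    · refine ⟨x 0 - (s + 1) • Y, ?_, ?_⟩ <;>
        simp only [dotProduct_sub, dotProduct_smul, hY, hs, hPx, smul_eq_mul] <;> ring

end

section

open Real

/-! ### The flow on the circle and its cocycles

In the coordinates `(c, s)` of the unit circle we use the flow
`(c, s) ↦ (e⁻ᵗ c, eᵗ s) / ‖(e⁻ᵗ c, eᵗ s)‖`. -/

/-- The norm of `(e⁻ᵗ c, eᵗ s)`. -/
def flowNorm (t c s : ℝ) : ℝ := √((exp (-t) * c) ^ 2 + (exp t * s) ^ 2)

/-- The signed angle from `(c, s)` to its image under the flow. -/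
def flowAngle (t c s : ℝ) : ℝ :=
  arctan ((exp t - exp (-t)) * (c * s) / (exp (-t) * c ^ 2 + exp t * s ^ 2))

/-- The function `(flowNorm t c s + e⁻ᵗ c) / (1 + c)` extended to `c = -1`. -/
def flowRatio (t c s : ℝ) : ℝ :=
  exp (-t) + (exp t ^ 2 - exp (-t) ^ 2) * (1 - c) / (flowNorm t c s + exp (-t))

/-- The integral of the first coordinate along the flow. -/
def flowIntegral (t c s : ℝ) : ℝ := (t - log (flowRatio t c s)) / 2

lemma exp_mul_exp_neg' (t : ℝ) : exp t * exp (-t) = 1 := by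
  rw [← exp_add, add_neg_cancel, exp_zero]

section

variable {c s : ℝ}

lemma flow_sq_pos (t : ℝ) (h : c ^ 2 + s ^ 2 = 1) :
    0 < (exp (-t) * c) ^ 2 + (exp t * s) ^ 2 := by
  by_cases hc : c = 0
  · have : s ≠ 0 := by rintro rfl; simp [hc] at h
    positivity
  · positivity

lemma flow_den_pos (t : ℝ) (h : c ^ 2 + s ^ 2 = 1) : 0 < exp (-t) * c ^ 2 + exp t * s ^ 2 := by
  by_cases hc : c = 0
  · have : s ≠ 0 := by rintro rfl; simp [hc] at h
    positivity
  · positivity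

lemma flowNorm_pos (t : ℝ) (h : c ^ 2 + s ^ 2 = 1) : 0 < flowNorm t c s :=
  sqrt_pos.2 (flow_sq_pos t h)

lemma flowNorm_sq (t : ℝ) : flowNorm t c s ^ 2 = (exp (-t) * c) ^ 2 + (exp t * s) ^ 2 :=
  sq_sqrt (by positivity)

lemma flowNorm_nonneg (t c s : ℝ) : 0 ≤ flowNorm t c s := sqrt_nonneg _

lemma flowNorm_add_pos (t c s : ℝ) : 0 < flowNorm t c s + exp (-t) :=
  add_pos_of_nonneg_of_pos (flowNorm_nonneg t c s) (exp_pos _)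

/-- Off `c = -1` this recovers the quotient whose logarithm integrates the first coordinate: `log
((N + e⁻ᵗ c) / (1 + c))`, with `N = flowNorm t c s`, has time derivative `1 - 2 e⁻ᵗ c / N`. -/
lemma flowRatio_mul (t : ℝ) (h : c ^ 2 + s ^ 2 = 1) :
    flowRatio t c s * (1 + c) = flowNorm t c s + exp (-t) * c := by
  have h1 := (flowNorm_add_pos t c s).ne'
  have h2 := flowNorm_sq (c := c) (s := s) t
  rw [flowRatio]
  field_simp
  linear_combination (-1) * h2 - exp t ^ 2 * h

lemma flowNorm_of_im_zero (t : ℝ) (h : c ^ 2 = 1) : flowNorm t c 0 = exp (-t) := by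
  rw [flowNorm, mul_zero, zero_pow two_ne_zero, add_zero, mul_pow, h, mul_one,
    sqrt_sq (exp_pos _).le]

lemma flowRatio_one (t : ℝ) : flowRatio t 1 0 = exp (-t) := by
  simp [flowRatio]

lemma flowRatio_neg_one (t : ℝ) : flowRatio t (-1) 0 = exp (3 * t) := by
  have h1 := exp_mul_exp_neg' t
  have h2 : exp (3 * t) = exp t ^ 3 := by rw [← exp_nat_mul]; norm_num
  rw [flowRatio, flowNorm_of_im_zero t (by norm_num), h2]
  have := (exp_pos (-t)).ne'
  field_simp
  linear_combination (-2 * exp t ^ 2) * h1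

/-- With `N = flowNorm t c s`, the product `(N + e⁻ᵗ c) (N - e⁻ᵗ c)` equals `e²ᵗ s²`, while `(1 + c)
(1 - c) = s²`; the points `s = 0` are checked by hand. Both the nonvanishing of `flowRatio` and the
oddness of `flowIntegral` in `c` come from here. -/
lemma flowRatio_mul_neg (t : ℝ) {s' : ℝ} (h : c ^ 2 + s ^ 2 = 1) (hs : s' ^ 2 = s ^ 2) :
    flowRatio t c s * flowRatio t (-c) s' = exp t ^ 2 := by
  have key (t : ℝ) : exp (-t) * exp (3 * t) = exp t ^ 2 := by
    rw [← exp_add, ← exp_nat_mul]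
    congr 1
    push_cast
    ring
  by_cases hs0 : s = 0
  · subst hs0
    have hs' : s' = 0 := by simpa using hs
    subst hs'
    rcases sq_eq_one_iff.1 (show c ^ 2 = 1 by simpa using h) with rfl | rfl
    · rw [flowRatio_one, flowRatio_neg_one, key]
    · rw [neg_neg, flowRatio_one, flowRatio_neg_one, mul_comm, key]
  · have h' : (-c) ^ 2 + s' ^ 2 = 1 := by rw [hs]; linarith [neg_sq c]
    have e1 := flowRatio_mul t h
    have e2 := flowRatio_mul t h'
    have hn : flowNorm t (-c) s' = flowNorm t c s := by
      simp only [flowNorm, mul_pow, hs, neg_sq]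
    rw [hn] at e2
    have h2 := flowNorm_sq (c := c) (s := s) t
    apply mul_right_cancel₀ (pow_ne_zero 2 hs0)
    linear_combination flowRatio t (-c) s' * (1 - c) * e1 +
      (flowNorm t c s + exp (-t) * c) * e2 + h2 + flowRatio t c s * flowRatio t (-c) s' * h

lemma flowRatio_ne_zero (t : ℝ) (h : c ^ 2 + s ^ 2 = 1) : flowRatio t c s ≠ 0 := fun h0 => by
  have := flowRatio_mul_neg t h rfl
  rw [h0, zero_mul] at this
  exact pow_ne_zero 2 (exp_pos t).ne' this.symm

lemma flowIntegral_neg (t : ℝ) {s' : ℝ} (h : c ^ 2 + s ^ 2 = 1) (hs : s' ^ 2 = s ^ 2) :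
    flowIntegral t (-c) s' = -flowIntegral t c s := by
  have h' : (-c) ^ 2 + s' ^ 2 = 1 := by rw [hs]; linarith [neg_sq c]
  have := congrArg log (flowRatio_mul_neg t h hs)
  rw [log_mul (flowRatio_ne_zero t h) (flowRatio_ne_zero t h'), log_pow, log_exp] at this
  push_cast at this
  rw [flowIntegral, flowIntegral]
  linarith

lemma flowIntegral_neg_right (t c s : ℝ) : flowIntegral t c (-s) = flowIntegral t c s := by
  simp [flowIntegral, flowRatio, flowNorm]

lemma flowIntegral_one (t : ℝ) : flowIntegral t 1 0 = t := by
  rw [flowIntegral, flowRatio_one, log_exp]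
  ring

lemma flowIntegral_neg_one (t : ℝ) : flowIntegral t (-1) 0 = -t := by
  rw [flowIntegral, flowRatio_neg_one, log_exp]
  ring

lemma flow_normalized (t : ℝ) (h : c ^ 2 + s ^ 2 = 1) :
    (exp (-t) * c / flowNorm t c s) ^ 2 + (exp t * s / flowNorm t c s) ^ 2 = 1 := by
  have := (flowNorm_pos t h).ne'
  rw [div_pow, div_pow, ← add_div, ← flowNorm_sq, div_self (pow_ne_zero 2 this)]

lemma flowNorm_flow (t r : ℝ) (h : c ^ 2 + s ^ 2 = 1) :
    flowNorm t (exp (-r) * c / flowNorm r c s) (exp r * s / flowNorm r c s) =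
      flowNorm (t + r) c s / flowNorm r c s := by
  have hp := flowNorm_pos r h
  rw [flowNorm.eq_def t, flowNorm.eq_def (t + r), neg_add, exp_add, exp_add]
  generalize flowNorm r c s = n at hp ⊢
  have hn : n = √(n ^ 2) := (sqrt_sq hp.le).symm
  conv_rhs => rw [hn]
  rw [← sqrt_div' _ (by positivity)]
  congr 1
  field_simp

/-- The quotients defining `flowRatio` telescope along the flow; only the removable singularity `c =
-1` needs separate treatment. -/
lemma flowRatio_flow (t r : ℝ) (h : c ^ 2 + s ^ 2 = 1) :
    flowRatio (t + r) c s = flowRatio r c s *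
      flowRatio t (exp (-r) * c / flowNorm r c s) (exp r * s / flowNorm r c s) := by
  by_cases hc : c = -1
  · have hs : s = 0 := by rw [hc] at h; simpa using h
    subst hs hc
    rw [flowNorm_of_im_zero r (by norm_num), flowRatio_neg_one, flowRatio_neg_one, mul_zero,
      zero_div, mul_neg_one, neg_div, div_self (exp_pos _).ne', flowRatio_neg_one, ← exp_add]
    congr 1
    ring
  · have hc' : 1 + c ≠ 0 := fun h => hc (by linarith)
    apply mul_right_cancel₀ hc'
    have e0 := flowRatio_mul (t + r) h
    have e1 := flowRatio_mul r h
    have e2 := flowRatio_mul t (flow_normalized r h)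
    have hp := (flowNorm_pos r h).ne'
    rw [flowNorm_flow t r h] at e2
    rw [e0, mul_right_comm, e1]
    rw [neg_add, exp_add]
    generalize flowRatio t (exp (-r) * c / flowNorm r c s) (exp r * s / flowNorm r c s) = X at *
    field_simp at e2
    linear_combination -e2

lemma flowIntegral_flow (t r : ℝ) (h : c ^ 2 + s ^ 2 = 1) :
    flowIntegral (t + r) c s = flowIntegral r c s +
      flowIntegral t (exp (-r) * c / flowNorm r c s) (exp r * s / flowNorm r c s) := by
  rw [flowIntegral, flowIntegral, flowIntegral, flowRatio_flow t r h,
    log_mul (flowRatio_ne_zero r h) (flowRatio_ne_zero t (flow_normalized r h))]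
  ring

/-- Exchanging the coordinates reverses time. Hence `-flowIntegral (-t) s c` integrates the second
coordinate along the flow. -/
lemma flowNorm_swap (t c s : ℝ) : flowNorm (-t) s c = flowNorm t c s := by
  rw [flowNorm, flowNorm, neg_neg, add_comm]

/-- Numerator and denominator of the tangent are the cross and inner products of `(c, s)` with `(e⁻ᵗ
c, eᵗ s)`. The inner product is positive, so the arctangent is the true angle. -/
lemma flowAngle_cos_sin (t : ℝ) (h : c ^ 2 + s ^ 2 = 1) :
    cos (flowAngle t c s) = (exp (-t) * c ^ 2 + exp t * s ^ 2) / flowNorm t c s ∧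
    sin (flowAngle t c s) = (exp t - exp (-t)) * (c * s) / flowNorm t c s := by
  have hd := flow_den_pos t h
  have key : √(1 + ((exp t - exp (-t)) * (c * s) / (exp (-t) * c ^ 2 + exp t * s ^ 2)) ^ 2) =
      flowNorm t c s / (exp (-t) * c ^ 2 + exp t * s ^ 2) := by
    rw [sqrt_eq_iff_mul_self_eq_of_pos (div_pos (flowNorm_pos t h) hd)]
    have h2 := flowNorm_sq (c := c) (s := s) t
    field_simp
    rw [h2]
    linear_combination (-(exp (-t) * c) ^ 2 - (exp t * s) ^ 2) * h
  have hn := (flowNorm_pos t h).ne'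
  constructor
  · rw [flowAngle, cos_arctan, key, one_div_div]
  · rw [flowAngle, sin_arctan, key]
    field_simp

end

/-! ### The circle flow and its displacement cocycle -/

/-- The first coordinate of a point of the circle. -/
abbrev cre (y : Circle) : ℝ := (y : ℂ).re

/-- The second coordinate of a point of the circle. -/
abbrev cim (y : Circle) : ℝ := (y : ℂ).im

lemma cre_sq_add_cim_sq (y : Circle) : cre y ^ 2 + cim y ^ 2 = 1 := by
  have := Circle.normSq_coe y
  rw [Complex.normSq_apply] at this
  linarith

lemma circle_ext' {y z : Circle} (h1 : cre y = cre z) (h2 : cim y = cim z) : y = z :=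
  Circle.ext (Complex.ext h1 h2)

lemma cre_mul (y z : Circle) : cre (y * z) = cre y * cre z - cim y * cim z := by
  rw [cre, Circle.coe_mul, Complex.mul_re]

lemma cim_mul (y z : Circle) : cim (y * z) = cre y * cim z + cim y * cre z := by
  rw [cim, Circle.coe_mul, Complex.mul_im]

lemma cre_exp (x : ℝ) : cre (Circle.exp x) = cos x := by
  rw [cre, Circle.coe_exp, Complex.exp_ofReal_mul_I_re]

lemma cim_exp (x : ℝ) : cim (Circle.exp x) = sin x := by
  rw [cim, Circle.coe_exp, Complex.exp_ofReal_mul_I_im]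

/-- The flow on the circle. -/
def circleFlow (t : ℝ) (y : Circle) : Circle :=
  y * Circle.exp (flowAngle t (cre y) (cim y))

lemma cre_circleFlow (t : ℝ) (y : Circle) :
    cre (circleFlow t y) = exp (-t) * cre y / flowNorm t (cre y) (cim y) := by
  have h := cre_sq_add_cim_sq y
  obtain ⟨h1, h2⟩ := flowAngle_cos_sin t h
  rw [circleFlow, cre_mul, cre_exp, cim_exp, h1, h2]
  have := (flowNorm_pos t h).ne'
  field_simp
  linear_combination exp (-t) * cre y * h

lemma cim_circleFlow (t : ℝ) (y : Circle) :
    cim (circleFlow t y) = exp t * cim y / flowNorm t (cre y) (cim y) := by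
  have h := cre_sq_add_cim_sq y
  obtain ⟨h1, h2⟩ := flowAngle_cos_sin t h
  rw [circleFlow, cim_mul, cre_exp, cim_exp, h1, h2]
  have := (flowNorm_pos t h).ne'
  field_simp
  linear_combination exp t * cim y * h

lemma circleFlow_add (t r : ℝ) (y : Circle) :
    circleFlow (t + r) y = circleFlow t (circleFlow r y) := by
  have h := cre_sq_add_cim_sq y
  have h1 := (flowNorm_pos r h).ne'
  apply circle_ext'
  · rw [cre_circleFlow, cre_circleFlow, cre_circleFlow, cim_circleFlow, flowNorm_flow t r h,
      neg_add, exp_add]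
    field_simp
  · rw [cim_circleFlow, cim_circleFlow, cre_circleFlow, cim_circleFlow, flowNorm_flow t r h,
      exp_add]
    field_simp

lemma circleFlow_eq_self {t : ℝ} (ht : t ≠ 0) {y : Circle} (h : circleFlow t y = y) :
    cre y = 0 ∨ cim y = 0 := by
  by_contra! h0
  have h1 := cre_circleFlow t y
  have h2 := cim_circleFlow t y
  have h3 := (flowNorm_pos t (cre_sq_add_cim_sq y)).ne'
  rw [h, eq_div_iff h3, mul_comm] at h1 h2
  have h4 := (mul_right_cancel₀ h0.1 h1).symm.trans (mul_right_cancel₀ h0.2 h2)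
  have := exp_injective h4
  exact ht (by linarith)

/-- The displacement of the flow on `𝕋³`, which depends on the first coordinate only. -/
def displ (t : ℝ) (y : Circle) : Fin 3 → ℝ :=
  ![flowAngle t (cre y) (cim y), flowIntegral t (cre y) (cim y),
    -flowIntegral (-t) (cim y) (cre y)]

lemma abs_flowAngle_lt (t c s : ℝ) : |flowAngle t c s| < π / 2 :=
  abs_lt.2 ⟨neg_pi_div_two_lt_arctan _, arctan_lt_pi_div_two _⟩

lemma displ_add (t r : ℝ) (y : Circle) :
    displ (t + r) y = displ r y + displ t (circleFlow r y) := by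
  have h := cre_sq_add_cim_sq y
  ext i
  fin_cases i
  · change flowAngle (t + r) (cre y) (cim y) = flowAngle r (cre y) (cim y) +
      flowAngle t (cre (circleFlow r y)) (cim (circleFlow r y))
    have h1 := circleFlow_add t r y
    rw [circleFlow, circleFlow.eq_def t, circleFlow.eq_def r y, mul_assoc, mul_left_cancel_iff,
      ← circleFlow.eq_def r y, ← Circle.exp_add, Circle.exp_eq_exp] at h1
    obtain ⟨m, hm⟩ := h1
    have b1 := abs_lt.1 (abs_flowAngle_lt (t + r) (cre y) (cim y))
    have b2 := abs_lt.1 (abs_flowAngle_lt r (cre y) (cim y))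
    have b3 := abs_lt.1 (abs_flowAngle_lt t (cre (circleFlow r y)) (cim (circleFlow r y)))
    have hpi := pi_pos
    -- The angles add up modulo `2π`, and each is smaller than `π / 2` in absolute value, so `2π |m|
    -- < 3π / 2`.
    have hm0 : m = 0 := by
      have h1 : (m : ℝ) < 1 := by nlinarith
      have h2 : (-1 : ℝ) < m := by nlinarith
      have h1' : m < 1 := by exact_mod_cast h1
      have h2' : -1 < m := by exact_mod_cast h2
      omega
    rw [hm, hm0]
    simp
  · change flowIntegral (t + r) (cre y) (cim y) = flowIntegral r (cre y) (cim y) +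
      flowIntegral t (cre (circleFlow r y)) (cim (circleFlow r y))
    rw [cre_circleFlow, cim_circleFlow, flowIntegral_flow t r h]
  · change -flowIntegral (-(t + r)) (cim y) (cre y) = -flowIntegral (-r) (cim y) (cre y) +
      -flowIntegral (-t) (cim (circleFlow r y)) (cre (circleFlow r y))
    have := flowIntegral_flow (-t) (-r) ((add_comm _ _).trans h)
    rw [flowNorm_swap, neg_neg] at this
    rw [cre_circleFlow, cim_circleFlow, neg_add, this]
    ring

lemma cre_neg (y : Circle) : cre (y * Circle.exp π) = -cre y := by
  rw [cre_mul, cre_exp, cim_exp, cos_pi, sin_pi]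
  ring

lemma cim_neg (y : Circle) : cim (y * Circle.exp π) = -cim y := by
  rw [cim_mul, cre_exp, cim_exp, cos_pi, sin_pi]
  ring

lemma displ_mul_exp_pi (t : ℝ) (y : Circle) :
    displ t (y * Circle.exp π) = ![displ t y 0, -displ t y 1, -displ t y 2] := by
  have h := cre_sq_add_cim_sq y
  have h0 : flowAngle t (-cre y) (-cim y) = flowAngle t (cre y) (cim y) := by
    simp [flowAngle]
  rw [displ, cre_neg, cim_neg, h0, flowIntegral_neg t h (neg_sq _),
    flowIntegral_neg (-t) ((add_comm _ _).trans h) (neg_sq _)]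
  rfl

lemma displ_inv (t : ℝ) (y : Circle) :
    displ t y⁻¹ = ![-displ t y 0, displ t y 1, -displ t y 2] := by
  have h := cre_sq_add_cim_sq y
  have hr : cre y⁻¹ = cre y := by rw [cre, Circle.coe_inv_eq_conj, Complex.conj_re]
  have hi : cim y⁻¹ = -cim y := by rw [cim, Circle.coe_inv_eq_conj, Complex.conj_im]
  have h0 : flowAngle t (cre y) (-cim y) = -flowAngle t (cre y) (cim y) := by
    simp [flowAngle, neg_div, arctan_neg]
  rw [displ, hr, hi, h0, flowIntegral_neg_right,
    flowIntegral_neg (-t) ((add_comm _ _).trans h) rfl]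
  rfl

/-- At a fixed point of the circle flow one coordinate is `±1` and stays so; its integral over time
`t` is `±t`. This is why the flow on `𝕋³` has no stationary points. -/
lemma displ_of_fixed {t : ℝ} (ht : t ≠ 0) {y : Circle} (h : circleFlow t y = y) :
    |displ t y 1| = |t| ∨ |displ t y 2| = |t| := by
  have h1 := cre_sq_add_cim_sq y
  rcases circleFlow_eq_self ht h with h0 | h0
  · right
    change |-flowIntegral (-t) (cim y) (cre y)| = |t|
    rw [h0] at h1 ⊢
    rcases sq_eq_one_iff.1 (show cim y ^ 2 = 1 by simpa using h1) with h2 | h2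
    · rw [h2, flowIntegral_one, neg_neg]
    · rw [h2, flowIntegral_neg_one, neg_neg, abs_neg]
  · left
    change |flowIntegral t (cre y) (cim y)| = |t|
    rw [h0] at h1 ⊢
    rcases sq_eq_one_iff.1 (show cre y ^ 2 = 1 by simpa using h1) with h2 | h2
    · rw [h2, flowIntegral_one]
    · rw [h2, flowIntegral_neg_one, abs_neg]

lemma contDiffAt_displ (t : ℝ) {q : ℝ × ℝ} (hq : q.1 ^ 2 + q.2 ^ 2 = 1) (i : Fin 3) :
    ContDiffAt ℝ ω (fun q : ℝ × ℝ => (![flowAngle t q.1 q.2, flowIntegral t q.1 q.2,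
      -flowIntegral (-t) q.2 q.1] : Fin 3 → ℝ) i) q := by
  have hI (t : ℝ) {q : ℝ × ℝ} (hq : q.1 ^ 2 + q.2 ^ 2 = 1) :
      ContDiffAt ℝ ω (fun q : ℝ × ℝ => flowIntegral t q.1 q.2) q := by
    have hn : ContDiffAt ℝ ω (fun q : ℝ × ℝ => flowNorm t q.1 q.2) q :=
      ContDiffAt.sqrt (by fun_prop) (flow_sq_pos t hq).ne'
    have hr : ContDiffAt ℝ ω (fun q : ℝ × ℝ => flowRatio t q.1 q.2) q :=
      contDiffAt_const.add (ContDiffAt.div (by fun_prop) (hn.add contDiffAt_const)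
        (flowNorm_add_pos t _ _).ne')
    exact (contDiffAt_const.sub (hr.log (flowRatio_ne_zero t hq))).div_const 2
  fin_cases i
  · have h1 : ContDiffAt ℝ ω (fun q : ℝ × ℝ => (exp t - exp (-t)) * (q.1 * q.2)) q := by
      fun_prop
    have h2 : ContDiffAt ℝ ω (fun q : ℝ × ℝ => exp (-t) * q.1 ^ 2 + exp t * q.2 ^ 2) q := by
      fun_prop
    exact contDiff_arctan.contDiffAt.comp q (h1.div h2 (flow_den_pos t hq).ne')
  · exact hI t hq
  · exact ((hI (-t) (q := q.swap) ((add_comm _ _).trans hq)).comp q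
      (contDiff_snd.prodMk contDiff_fst).contDiffAt).neg

end

section

open Matrix

/-! ### Free actions with Klein linear part -/

/-- The affine diffeomorphism of `𝕋³` with linear part `A` and translation vector `τ`. -/
def affineDiffeo (A : (Matrix (Fin 3) (Fin 3) ℤ)ˣ) (τ : Fin 3 → ℝ) : AnalyticDiffeo where
  toFun z := toral A.val z * torusExp τ
  invFun z := toral A⁻¹.val z * torusExp (realMat A⁻¹.val *ᵥ (-τ))
  left_inv z := by
    change toral A⁻¹.val (toral A.val z * torusExp τ) * torusExp (realMat A⁻¹.val *ᵥ (-τ)) = z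
    rw [toral_mul, ← toral_torusExp, mul_assoc, ← toral_mul, ← torusExp_add, ← toral_comp,
      add_neg_cancel, toral_torusExp]
    simp
  right_inv z := by
    change toral A.val (toral A⁻¹.val z * torusExp (realMat A⁻¹.val *ᵥ (-τ))) * torusExp τ = z
    rw [toral_mul, toral_torusExp, mulVec_mulVec, ← realMat_mul, ← toral_comp, mul_assoc,
      ← torusExp_add]
    simp
  contMDiff_toFun := contMDiff_toral_mul_torusExp _ fun _ => contMDiff_const
  contMDiff_invFun := contMDiff_toral_mul_torusExp _ fun _ => contMDiff_const

lemma affineDiffeo_apply (A : (Matrix (Fin 3) (Fin 3) ℤ)ˣ) (τ : Fin 3 → ℝ) (z : Torus3) :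
    affineDiffeo A τ z = toral A.val z * torusExp τ := rfl

lemma hasLinearPart_affineDiffeo (A : (Matrix (Fin 3) (Fin 3) ℤ)ˣ) (τ : Fin 3 → ℝ) :
    HasLinearPart (affineDiffeo A τ) A.val :=
  ⟨fun _ => τ, continuous_const, affineDiffeo_apply A τ⟩

lemma affineDiffeo_commute {A B : (Matrix (Fin 3) (Fin 3) ℤ)ˣ} {σ τ : Fin 3 → ℝ}
    (h : A.val * B.val = B.val * A.val) {u : Fin 3 → ℤ}
    (hu : realMat A.val *ᵥ τ + σ = realMat B.val *ᵥ σ + τ + period u) :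
    Commute (affineDiffeo A σ) (affineDiffeo B τ) := by
  refine Diffeomorph.ext fun z => ?_
  rw [analyticDiffeo_mul_apply, analyticDiffeo_mul_apply]
  simp only [affineDiffeo_apply, toral_mul, ← toral_comp, toral_torusExp, mul_assoc,
    ← torusExp_add, h]
  rw [hu, torusExp_add _ (period u), torusExp_period, mul_one]

lemma toral_affineDiffeo {A : (Matrix (Fin 3) (Fin 3) ℤ)ˣ} {P D : Matrix (Fin 3) (Fin 3) ℤ}
    (h : P * A.val = D * P) (τ : Fin 3 → ℝ) (z : Torus3) :
    toral P (affineDiffeo A τ z) = toral D (toral P z) * torusExp (realMat P *ᵥ τ) := by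
  rw [affineDiffeo_apply, toral_mul, ← toral_comp, h, toral_comp, toral_torusExp]

/-- The diffeomorphisms that preserve the fibres of `toral P`. -/
def fiberSubgroup (P : Matrix (Fin 3) (Fin 3) ℤ) : Subgroup AnalyticDiffeo where
  carrier := {f | ∀ z, toral P (f z) = toral P z}
  mul_mem' {f g} hf hg z := by rw [analyticDiffeo_mul_apply, hf, hg]
  one_mem' _ := rfl
  inv_mem' {f} hf z := by rw [← hf (f⁻¹ z), ← analyticDiffeo_mul_apply, mul_inv_cancel]; rfl

lemma affineDiffeo_sq_mem {A : (Matrix (Fin 3) (Fin 3) ℤ)ˣ} {P D : Matrix (Fin 3) (Fin 3) ℤ}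
    (h : P * A.val = D * P) (hD : D * D = 1) {τ : Fin 3 → ℝ} {k : Fin 3 → ℤ}
    (hτ : realMat D *ᵥ (realMat P *ᵥ τ) + realMat P *ᵥ τ = period k) :
    affineDiffeo A τ ^ 2 ∈ fiberSubgroup P := fun z => by
  rw [pow_two, analyticDiffeo_mul_apply, toral_affineDiffeo h, toral_affineDiffeo h, toral_mul,
    ← toral_comp, hD, toral_one, toral_torusExp, mul_assoc, ← torusExp_add, hτ, torusExp_period,
    mul_one]

/-! ### The flow on the torus in the coordinates `toral P` -/

section

variable {P : Matrix (Fin 3) (Fin 3) ℤ} {Q : Matrix (Fin 3) (Fin 3) ℝ}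

lemma toral_mul_torusExp_mulVec (hPQ : realMat P * Q = 1) (z : Torus3) (v : Fin 3 → ℝ) :
    toral P (z * torusExp (Q *ᵥ v)) = toral P z * torusExp v := by
  rw [toral_mul, toral_torusExp, mulVec_mulVec, hPQ, one_mulVec]

lemma contMDiff_displ (P : Matrix (Fin 3) (Fin 3) ℤ) (Q : Matrix (Fin 3) (Fin 3) ℝ) (t : ℝ)
    (i : Fin 3) : ContMDiff torusModel 𝓘(ℝ, ℝ) ω
      fun z : Torus3 => (Q *ᵥ displ t (coords (toral P z) 0)) i := by
  have hd (j : Fin 3) : ContMDiff torusModel 𝓘(ℝ, ℝ) ω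
      fun z : Torus3 => displ t (coords (toral P z) 0) j := by
    intro z
    have h1 := (contDiffAt_displ t (q := (cre (coords (toral P z) 0), cim (coords (toral P z) 0)))
      (cre_sq_add_cim_sq _) j).contMDiffAt
    have h2 := ((contMDiff_re_im 0).comp (contMDiff_toral P)).contMDiffAt (x := z)
    have h3 := h1.comp z h2
    exact h3
  have hs : ContDiff ℝ ω fun v : Fin 3 → ℝ => Q *ᵥ v :=
    (LinearMap.toContinuousLinearMap Q.mulVecLin).contDiff
  exact (contDiff_pi.1 hs i).contMDiff.comp (contMDiff_pi_space.2 hd)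

/-- The flow on `𝕋³` that covers the circle flow through the first coordinate of `toral P`. -/
def kleinFlow (hPQ : realMat P * Q = 1) : Multiplicative ℝ →* AnalyticDiffeo :=
  actionHom (fun t z => z * torusExp (Q *ᵥ displ t.toAdd (coords (toral P z) 0)))
    (fun z => by
      have := displ_add 0 0 (coords (toral P z) 0)
      have h0 : circleFlow 0 (coords (toral P z) 0) = coords (toral P z) 0 := by
        simp [circleFlow, flowAngle]
      rw [h0, add_zero, left_eq_add] at this
      simp [this])
    (fun t r z => by
      rw [toral_mul_torusExp_mulVec hPQ, toAdd_mul, displ_add, mulVec_add, torusExp_add,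
        coords_mul, coords_torusExp, mul_assoc]
      rfl)
    (fun t => by simpa using contMDiff_toral_mul_torusExp 1 (contMDiff_displ P Q t.toAdd))

lemma kleinFlow_apply (hPQ : realMat P * Q = 1) (t : ℝ) (z : Torus3) :
    kleinFlow hPQ (Multiplicative.ofAdd t) z =
      z * torusExp (Q *ᵥ displ t (coords (toral P z) 0)) := rfl

lemma hasLinearPart_kleinFlow (hPQ : realMat P * Q = 1) (t : ℝ) :
    HasLinearPart (kleinFlow hPQ (Multiplicative.ofAdd t)) 1 :=
  ⟨_, continuous_pi fun i => (contMDiff_displ P Q t i).continuous, fun z => by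
    rw [toral_one, kleinFlow_apply]⟩

lemma toral_kleinFlow (hPQ : realMat P * Q = 1) (t : ℝ) (z : Torus3) :
    toral P (kleinFlow hPQ (Multiplicative.ofAdd t) z) =
      toral P z * torusExp (displ t (coords (toral P z) 0)) := by
  rw [kleinFlow_apply, toral_mul_torusExp_mulVec hPQ]

lemma kleinFlow_commute (hPQ : realMat P * Q = 1) {A : (Matrix (Fin 3) (Fin 3) ℤ)ˣ}
    {D : Matrix (Fin 3) (Fin 3) ℤ} (h : P * A.val = D * P) {τ : Fin 3 → ℝ} {t : ℝ}
    (hd : ∀ w, displ t (coords (toral D w * torusExp (realMat P *ᵥ τ)) 0) =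
      realMat D *ᵥ displ t (coords w 0)) :
    Commute (affineDiffeo A τ) (kleinFlow hPQ (Multiplicative.ofAdd t)) := by
  have hAQ : realMat A.val * Q = Q * realMat D := by
    have hQP : Q * realMat P = 1 := mul_eq_one_comm.1 hPQ
    calc realMat A.val * Q = Q * realMat P * realMat A.val * Q := by rw [hQP, one_mul]
      _ = Q * realMat D * (realMat P * Q) := by
        rw [mul_assoc Q, ← realMat_mul, h, realMat_mul, ← mul_assoc, mul_assoc]
      _ = Q * realMat D := by rw [hPQ, mul_one]
  refine Diffeomorph.ext fun z => ?_
  rw [analyticDiffeo_mul_apply, analyticDiffeo_mul_apply, kleinFlow_apply, kleinFlow_apply,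
    toral_affineDiffeo h, hd, affineDiffeo_apply, affineDiffeo_apply, toral_mul, toral_torusExp,
    mulVec_mulVec, hAQ, ← mulVec_mulVec, mul_right_comm]

/-- A return in all coordinates fixes the first one, where `displ_of_fixed` makes another
displacement `±t`; being a period, it lies in `2πℤ`. -/
lemma exists_eq_of_toral_kleinFlow_eq (hPQ : realMat P * Q = 1) {t : ℝ} {z : Torus3}
    (h : toral P (kleinFlow hPQ (Multiplicative.ofAdd t) z) = toral P z) :
    ∃ k : ℤ, t = 2 * Real.pi * k := by
  by_cases ht : t = 0
  · exact ⟨0, by simp [ht]⟩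
  rw [toral_kleinFlow, mul_eq_left] at h
  have h0 : circleFlow t (coords (toral P z) 0) = coords (toral P z) 0 := by
    have := congrArg (fun w => coords w 0) h
    simp only [coords_torusExp, coords_one] at this
    exact mul_eq_left.2 this
  obtain ⟨k, hk⟩ := torusExp_eq_one_iff.1 h
  have key (i : Fin 3) (hi : |displ t (coords (toral P z) 0) i| = |t|) :
      ∃ k : ℤ, t = 2 * Real.pi * k := by
    rw [hk] at hi
    rcases abs_eq_abs.1 hi with hi | hi
    · exact ⟨k i, hi.symm⟩
    · exact ⟨-k i, by simp only [period] at hi; push_cast; linarith⟩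
  exact (displ_of_fixed ht h0).elim (key 1) (key 2)

end

lemma kleinMat_zero : kleinMat 0 0 = 1 := by
  rw [kleinMat, ← diagonal_one]
  congr 1
  ext i
  fin_cases i <;> simp

/-- The pairs of a diffeomorphism and exponents of the Klein group that are compatible with the
action on homology in the coordinates given by `P`. -/
def kleinSubgroup (P : Matrix (Fin 3) (Fin 3) ℤ) :
    Subgroup (AnalyticDiffeo × Multiplicative (ℤ × ℤ)) where
  carrier := {x | P * homologyMatrix (homologyAction x.1) =
    kleinMat x.2.toAdd.1 x.2.toAdd.2 * P}
  mul_mem' {x y} (hx : _ = _) (hy : _ = _) := by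
    change P * homologyMatrix (homologyAction (x.1 * y.1)) =
      kleinMat (x.2.toAdd.1 + y.2.toAdd.1) (x.2.toAdd.2 + y.2.toAdd.2) * P
    rw [map_mul, homologyMatrix_mul, ← mul_assoc, hx, mul_assoc, hy, ← mul_assoc, ← kleinMat_add]
  one_mem' := by
    change P * homologyMatrix (homologyAction 1) = kleinMat 0 0 * P
    rw [map_one, homologyMatrix_one, kleinMat_zero, mul_one, one_mul]
  inv_mem' {x} (hx : _ = _) := by
    change P * homologyMatrix (homologyAction x.1⁻¹) =
      kleinMat (-x.2.toAdd.1) (-x.2.toAdd.2) * P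
    have h1 : kleinMat x.2.toAdd.1 x.2.toAdd.2 * (P * homologyMatrix (homologyAction x.1⁻¹)) =
        P := by
      rw [← mul_assoc, ← hx, mul_assoc, ← homologyMatrix_mul, ← map_mul, mul_inv_cancel, map_one,
        homologyMatrix_one, mul_one]
    conv_rhs => rw [← h1]
    rw [← mul_assoc, ← kleinMat_add, neg_add_cancel, neg_add_cancel, kleinMat_zero, one_mul]

lemma homologyMatrix_homologyAction {f : AnalyticDiffeo} {M : Matrix (Fin 3) (Fin 3) ℤ}
    (h : HasLinearPart f M) : homologyMatrix (homologyAction f) = M := by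
  apply Matrix.mulVec_injective
  ext1 v
  obtain ⟨x, rfl⟩ := homologyEquiv.surjective v
  rw [homologyMatrix_mulVec]
  exact HasLinearPart.homologyEquiv_inducedH1 (f := ⟨f, f.continuous⟩) h x

theorem exists_free_klein_action {p : ℕ} {M : (Fin p → ℤ) → Matrix (Fin 3) (Fin 3) ℤ}
    (M_zero : M 0 = 1) (M_add : ∀ a b, M (a + b) = M a * M b) (n₁ n₂ : (Fin p → ℤ) →+ ℤ)
    {g h : Fin p → ℤ} (hg₁ : Odd (n₁ g)) (hg₂ : Even (n₂ g)) (hh₁ : Even (n₁ h))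
    (hh₂ : Odd (n₂ h)) {P : Matrix (Fin 3) (Fin 3) ℤ} (hP : P.det ≠ 0)
    (hPM : ∀ l, P * M l = kleinMat (n₁ l) (n₂ l) * P) {u : Fin 3 → ℤ} {k : ℤ}
    (hu : P *ᵥ u = ![1, -1, k]) :
    ∃ φ : Multiplicative (Fin p → ℤ) →* AnalyticDiffeo, FreeAction φ ∧
      ∀ l, homologyMatrix (homologyAction (φ (Multiplicative.ofAdd l))) = M l := by
  obtain ⟨Q, hPQ⟩ : ∃ Q, realMat P * Q = 1 := by
    refine ⟨(realMat P)⁻¹, mul_nonsing_inv _ ?_⟩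
    have : (realMat P).det = (P.det : ℝ) := ((Int.castRingHom ℝ).map_det P).symm
    rw [this, isUnit_iff_ne_zero]
    exact_mod_cast hP
  have hQP : Q * realMat P = 1 := mul_eq_one_comm.1 hPQ
  have hinj {x y : Fin 3 → ℝ} (hxy : realMat P *ᵥ x = realMat P *ᵥ y) : x = y := by
    simpa [mulVec_mulVec, hQP] using congrArg (Q *ᵥ ·) hxy
  let U (l : Fin p → ℤ) : (Matrix (Fin 3) (Fin 3) ℤ)ˣ :=
    ⟨M l, M (-l), by rw [← M_add, add_neg_cancel, M_zero],
      by rw [← M_add, neg_add_cancel, M_zero]⟩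
  have h1 : P * (U g).val = diagonal ![1, -1, -1] * P := by
    rw [← kleinMat_of_odd_even hg₁ hg₂]; exact hPM g
  have h2 : P * (U h).val = diagonal ![-1, 1, -1] * P := by
    rw [← kleinMat_of_even_odd hh₁ hh₂]; exact hPM h
  have hP1 (v : Fin 3 → ℝ) : realMat P *ᵥ (Q *ᵥ v) = v := by rw [mulVec_mulVec, hPQ, one_mulVec]
  have hPA {A D : Matrix (Fin 3) (Fin 3) ℤ} (hA : P * A = D * P) (v : Fin 3 → ℝ) :
      realMat P *ᵥ (realMat A *ᵥ (Q *ᵥ v)) = realMat D *ᵥ v := by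
    rw [mulVec_mulVec, ← realMat_mul, hA, realMat_mul, ← mulVec_mulVec, hP1]
  have hD1 (v : Fin 3 → ℝ) : realMat (diagonal ![1, -1, -1]) *ᵥ v = ![v 0, -v 1, -v 2] := by
    ext i; fin_cases i <;> simp [mulVec, dotProduct, diagonal]
  have hD2 (v : Fin 3 → ℝ) : realMat (diagonal ![-1, 1, -1]) *ᵥ v = ![-v 0, v 1, -v 2] := by
    ext i; fin_cases i <;> simp [mulVec, dotProduct, diagonal]
  let e₁ : Fin 3 → ℝ := ![Real.pi, 0, 0]
  -- The commutator of `f₁` and `f₂` is a translation by `2π (1, -1, k)` in the coordinates of `P`.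
  -- The third entry is adapted to `k` so that this is the image of the period of `u`.
  let e₂ : Fin 3 → ℝ := ![0, Real.pi, -Real.pi * k]
  let f₁ := affineDiffeo (U g) (Q *ᵥ e₁)
  let f₂ := affineDiffeo (U h) (Q *ᵥ e₂)
  have h12 : Commute f₁ f₂ := by
    refine affineDiffeo_commute (u := u) ?_ (hinj ?_)
    · change M g * M h = M h * M g
      rw [← M_add, ← M_add, add_comm]
    · rw [mulVec_add, mulVec_add, mulVec_add, realMat_mulVec_period, hu, hPA h1, hPA h2, hP1, hP1,
        hD1, hD2]
      ext i
      fin_cases i <;> simp [e₁, e₂, period] <;> ring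
  have h1t (t : ℝ) : Commute f₁ (kleinFlow hPQ (Multiplicative.ofAdd t)) := by
    refine kleinFlow_commute hPQ h1 fun w => ?_
    rw [hP1, hD1, coords_mul, coords_torusExp, ← displ_mul_exp_pi]
    congr 2
    simp [toral, diagonal]
  have h2t (t : ℝ) : Commute f₂ (kleinFlow hPQ (Multiplicative.ofAdd t)) := by
    refine kleinFlow_commute hPQ h2 fun w => ?_
    rw [hP1, hD2, coords_mul, coords_torusExp, ← displ_inv]
    congr 1
    simp [toral, diagonal, e₂]
  have h1f : f₁ ^ 2 ∈ fiberSubgroup P := by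
    refine affineDiffeo_sq_mem (k := ![1, 0, 0]) h1 ?_ ?_
    · ext i j; fin_cases i <;> fin_cases j <;> simp [mul_apply, diagonal]
    · rw [hP1, hD1]
      ext i; fin_cases i <;> simp [e₁, period]; ring
  have h2f : f₂ ^ 2 ∈ fiberSubgroup P := by
    refine affineDiffeo_sq_mem (k := ![0, 1, 0]) h2 ?_ ?_
    · ext i j; fin_cases i <;> fin_cases j <;> simp [mul_apply, diagonal]
    · rw [hP1, hD2]
      ext i; fin_cases i <;> simp [e₂, period]; ring
  obtain ⟨α, hα⟩ := exists_irrational_family (Fin p)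
  let s (l : Fin p → ℤ) : ℝ := Real.pi * ∑ i, (l i : ℝ) * α i
  have hs (a b) : s (a + b) = s a + s b := by
    simp only [s, Pi.add_apply, Int.cast_add, add_mul, Finset.sum_add_distrib, mul_add]
  let φ : Multiplicative (Fin p → ℤ) →* AnalyticDiffeo := MonoidHom.mk'
    (fun l => f₁ ^ n₁ l.toAdd * f₂ ^ n₂ l.toAdd * kleinFlow hPQ (Multiplicative.ofAdd (s l.toAdd)))
    fun a b => by
      have c12 := h12.zpow_zpow (n₁ b.toAdd) (n₂ a.toAdd)
      have ct := ((h1t (s a.toAdd)).zpow_left (n₁ b.toAdd)).mul_left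
        ((h2t (s a.toAdd)).zpow_left (n₂ b.toAdd))
      rw [toAdd_mul, map_add, map_add, hs, ofAdd_add, map_mul, _root_.zpow_add, _root_.zpow_add,
        c12.mul_mul_mul_comm, ct.mul_mul_mul_comm]
  refine ⟨φ, fun l hl z hz => hl ?_, fun l => ?_⟩
  -- Doubling `l` makes the exponents even, and even powers of `f₁` and `f₂` are invisible in the
  -- coordinates `toral P`. Only the flow at time `2 * s l` remains, which must lie in `2πℤ`.
  · have hz2 : φ (Multiplicative.ofAdd (l + l)) z = z := by
      rw [ofAdd_add, map_mul, analyticDiffeo_mul_apply, hz, hz]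
    have hmem : f₁ ^ n₁ (l + l) * f₂ ^ n₂ (l + l) ∈ fiberSubgroup P := by
      rw [map_add, map_add, ← two_mul, ← two_mul, _root_.zpow_mul, _root_.zpow_mul]
      exact mul_mem (zpow_mem (by exact_mod_cast h1f) _) (zpow_mem (by exact_mod_cast h2f) _)
    have hz3 := hmem (kleinFlow hPQ (Multiplicative.ofAdd (s (l + l))) z)
    rw [← analyticDiffeo_mul_apply] at hz3
    obtain ⟨m, hm⟩ := exists_eq_of_toral_kleinFlow_eq hPQ
      (hz3.symm.trans (congrArg (toral P) hz2))
    have hm' : ∑ i, (((l i : ℤ) : ℚ) : ℝ) * α i = ((m : ℚ) : ℝ) := by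
      rw [hs] at hm
      apply mul_left_cancel₀ Real.pi_ne_zero
      push_cast
      linarith
    funext i
    have hi : (l i : ℚ) = 0 := congrFun (hα _ _ hm') i
    exact_mod_cast hi
  · have m1 : (f₁, Multiplicative.ofAdd ((1, 0) : ℤ × ℤ)) ∈ kleinSubgroup P := by
      change P * homologyMatrix (homologyAction f₁) = kleinMat 1 0 * P
      rw [homologyMatrix_homologyAction (hasLinearPart_affineDiffeo _ _), h1,
        kleinMat_of_odd_even odd_one Even.zero]
    have m2 : (f₂, Multiplicative.ofAdd ((0, 1) : ℤ × ℤ)) ∈ kleinSubgroup P := by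
      change P * homologyMatrix (homologyAction f₂) = kleinMat 0 1 * P
      rw [homologyMatrix_homologyAction (hasLinearPart_affineDiffeo _ _), h2,
        kleinMat_of_even_odd Even.zero odd_one]
    have mt : (kleinFlow hPQ (Multiplicative.ofAdd (s l)), Multiplicative.ofAdd ((0, 0) : ℤ × ℤ)) ∈
        kleinSubgroup P := by
      change P * homologyMatrix (homologyAction _) = kleinMat 0 0 * P
      rw [homologyMatrix_homologyAction (hasLinearPart_kleinFlow hPQ (s l)), kleinMat_zero,
        mul_one, one_mul]
    have := mul_mem (mul_mem (zpow_mem m1 (n₁ l)) (zpow_mem m2 (n₂ l))) mt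
    have hl : P * homologyMatrix (homologyAction (φ (Multiplicative.ofAdd l))) =
        kleinMat (n₁ l * 1 + n₂ l * 0 + 0) (n₁ l * 0 + n₂ l * 1 + 0) * P := this
    simp only [mul_zero, mul_one, add_zero, zero_add] at hl
    rw [← hPM] at hl
    have hinjM : Function.Injective fun N : Matrix (Fin 3) (Fin 3) ℤ => P * N := fun N N' hN => by
      have := congrArg (P.adjugate * ·) hN
      simp only [← mul_assoc, adjugate_mul, smul_mul, one_mul] at this
      exact smul_right_injective _ hP this
    exact hinjM hl

/-! ### Realization of spectrally unitary actions -/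

lemma dotProduct_eq_zero_of_mulVec_eq_neg {B : Matrix (Fin 3) (Fin 3) ℚ} {v w : Fin 3 → ℚ}
    (hw : w ᵥ* B = w) (hv : B *ᵥ v = -v) : v ⬝ᵥ w = 0 := by
  have h : w ⬝ᵥ v = -(w ⬝ᵥ v) := by
    rw [← dotProduct_neg, ← hv, dotProduct_mulVec, hw]
  rw [dotProduct_comm]
  linarith

/-- A fixed covector kills every vector that `B` or `C` negates, hence all three `v i`. These are
independent because their sign patterns differ. -/
lemma eq_zero_of_vecMul_eq_of_klein {B C : Matrix (Fin 3) (Fin 3) ℚ} {v : Fin 3 → Fin 3 → ℚ}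
    (hv : ∀ i, v i ≠ 0) (hB0 : B *ᵥ v 0 = v 0) (hB1 : B *ᵥ v 1 = -v 1) (hB2 : B *ᵥ v 2 = -v 2)
    (hC0 : C *ᵥ v 0 = -v 0) (hC1 : C *ᵥ v 1 = v 1) (hC2 : C *ᵥ v 2 = -v 2) {w : Fin 3 → ℚ}
    (hB : w ᵥ* B = w) (hC : w ᵥ* C = w) : w = 0 := by
  by_contra hw
  have h0 : (of v) *ᵥ w = 0 := by
    ext i
    fin_cases i
    exacts [dotProduct_eq_zero_of_mulVec_eq_neg hC hC0, dotProduct_eq_zero_of_mulVec_eq_neg hB hB1,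
      dotProduct_eq_zero_of_mulVec_eq_neg hB hB2]
  obtain ⟨c, hc, hcv⟩ := exists_vecMul_eq_zero_iff.2 (exists_mulVec_eq_zero_iff.1 ⟨w, hw, h0⟩)
  have e1 : c 0 • v 0 + c 1 • v 1 + c 2 • v 2 = 0 := by
    rw [← hcv, vecMul_eq_sum, Fin.sum_univ_three]
    rfl
  have e2 := congrArg (B *ᵥ ·) e1
  have e3 := congrArg (C *ᵥ ·) e1
  simp only [mulVec_add, mulVec_smul, hB0, hB1, hB2, hC0, hC1, hC2, mulVec_zero] at e2 e3
  refine hc (funext fun i => ?_)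
  have key (i : Fin 3) (h : c i • v i = 0) : c i = 0 := (smul_eq_zero.1 h).resolve_right (hv i)
  have f1 (j) := congrFun e1 j
  have f2 (j) := congrFun e2 j
  have f3 (j) := congrFun e3 j
  simp only [Pi.add_apply, Pi.smul_apply, Pi.neg_apply, Pi.zero_apply, smul_eq_mul] at f1 f2 f3
  fin_cases i
  · exact key 0 (funext fun j => by change c 0 * v 0 j = 0; linarith [f1 j, f2 j])
  · exact key 1 (funext fun j => by change c 1 * v 1 j = 0; linarith [f1 j, f3 j])
  · exact key 2 (funext fun j => by change c 2 * v 2 j = 0; linarith [f2 j, f3 j])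

lemma det_ratMat_homologyMatrix_sub_one {B : H1Torus3 →ₗ[ℤ] H1Torus3}
    (hB : Module.End.HasEigenvalue B 1) : (ratMat (homologyMatrix B) - 1).det = 0 := by
  obtain ⟨x, hx⟩ := hB.exists_hasEigenvector
  have h1 : homologyMatrix B *ᵥ homologyEquiv x = homologyEquiv x := by
    rw [homologyMatrix_mulVec, hx.apply_eq_smul]
    exact (homologyEquiv.map_smul 1 x).trans (one_smul ℤ _)
  refine exists_mulVec_eq_zero_iff.1 ⟨fun i => (homologyEquiv x i : ℚ), fun h => ?_, ?_⟩
  · refine hx.2 (homologyEquiv.map_eq_zero_iff.1 (funext fun i => ?_))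
    have hi : (homologyEquiv x i : ℚ) = 0 := congrFun h i
    exact_mod_cast hi
  · rw [sub_mulVec, one_mulVec, sub_eq_zero]
    funext i
    rw [← congrFun h1 i]
    simp [mulVec, dotProduct]

theorem exists_free_action {p : ℕ} {M : (Fin p → ℤ) → Matrix (Fin 3) (Fin 3) ℤ}
    (M_zero : M 0 = 1) (M_add : ∀ a b, M (a + b) = M a * M b)
    (hM : ∀ l, (ratMat (M l) - 1).det = 0) :
    ∃ φ : Multiplicative (Fin p → ℤ) →* AnalyticDiffeo, FreeAction φ ∧
      ∀ l, homologyMatrix (homologyAction (φ (Multiplicative.ofAdd l))) = M l := by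
  have hadd (a b : Fin p → ℤ) : ratMat (M (a + b)) = ratMat (M a) * ratMat (M b) := by
    rw [M_add]
    exact Matrix.map_mul (f := Int.castRingHom ℚ)
  rcases exists_fixed_or_klein (fun l => (ratMat (M l))ᵀ)
      (fun a b => by rw [add_comm, hadd, transpose_mul])
      (fun l => by rw [← transpose_one, ← transpose_sub, det_transpose, hM]) with
    ⟨w, hw0, hw⟩ | ⟨n₁, n₂, w, ⟨g, h, hg₁, hg₂, hh₁, hh₂⟩, hw0, hw⟩
  · simp only [mulVec_transpose] at hw
    rcases exists_fixed_or_klein (fun l => ratMat (M l)) hadd hM with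
      ⟨v, hv0, hv⟩ | ⟨n₁, n₂, v, ⟨g, h, hg₁, hg₂, hh₁, hh₂⟩, hv0, hv⟩
    · obtain ⟨ι, _, t, ht, hsep⟩ := hasSeparatingCocycles_of_fixed hadd hv0 hw0 hv hw
      obtain ⟨φ, hφ, hlin⟩ := exists_free_affine_action M M_zero M_add t ht hsep
      exact ⟨φ, hφ, fun l => homologyMatrix_homologyAction (hlin l)⟩
    · obtain ⟨a0, a1, a2⟩ := hv g
      obtain ⟨b0, b1, b2⟩ := hv h
      rw [hg₂.neg_one_zpow, one_smul] at a0
      rw [hg₁.neg_one_zpow, neg_one_smul] at a1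
      rw [(hg₁.add_even hg₂).neg_one_zpow, neg_one_smul] at a2
      rw [hh₂.neg_one_zpow, neg_one_smul] at b0
      rw [hh₁.neg_one_zpow, one_smul] at b1
      rw [(hh₁.add_odd hh₂).neg_one_zpow, neg_one_smul] at b2
      exact absurd (eq_zero_of_vecMul_eq_of_klein hv0 a0 a1 a2 b0 b1 b2 (hw g) (hw h)) hw0
  · simp only [mulVec_transpose] at hw
    -- The Klein alternative for the transposes supplies eigencovectors of `M`, which become the
    -- rows of `P`.
    obtain ⟨P, hP, hPM, u, k, hu⟩ := exists_kleinMat_conj hw0 hg₁ hg₂ hh₁ hh₂ hw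
    exact exists_free_klein_action M_zero M_add n₁ n₂ hg₁ hg₂ hh₁ hh₂ hP hPM hu

end

end FreeTorusActions

end

theorem theorem1 (p : ℕ) (hp : 2 ≤ p)
    (A : Multiplicative (Fin p → ℤ) →*
      (FreeTorusActions.H1Torus3 ≃ₗ[ℤ] FreeTorusActions.H1Torus3))
    (hA : FreeTorusActions.SpectrallyUnitary A) :
    ∃ φ : Multiplicative (Fin p → ℤ) →* FreeTorusActions.AnalyticDiffeo,
      FreeTorusActions.FreeAction φ ∧ FreeTorusActions.InducedActionEq φ A := by
  obtain ⟨φ, hφ, hM⟩ := FreeTorusActions.exists_free_action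
    (M := fun l => FreeTorusActions.homologyMatrix (A (Multiplicative.ofAdd l)).toLinearMap)
    (by rw [ofAdd_zero, map_one]; exact FreeTorusActions.homologyMatrix_one)
    (fun a b => by rw [ofAdd_add, map_mul]; exact FreeTorusActions.homologyMatrix_mul _ _)
    (fun l => FreeTorusActions.det_ratMat_homologyMatrix_sub_one (hA l))
  refine ⟨φ, hφ, fun l => LinearMap.ext fun x => FreeTorusActions.homologyEquiv.injective ?_⟩
  have h1 := FreeTorusActions.homologyMatrix_mulVec
    (FreeTorusActions.homologyAction (φ (Multiplicative.ofAdd l))) x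
  rw [hM, FreeTorusActions.homologyMatrix_mulVec] at h1
  exact h1.symm
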